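/- An \emph{oriented abelian group} is an abelian group $A$ with a ternary relation $\mathcal O$ that is cyclic ($\mathcal O(x,y,z)\Rightarrow\mathcal O(y,z,x)$), invariant under translations, and such that $x<_0y:\Leftrightarrow x\neq y\wedge\mathcal O(0,x,y)$ is a strict linear order on $A\setminus\{0\}$ ($\mathcal O(0,x,y)$ holding only for distinct nonzero $x,y$). It is \emph{regularly dense} if for every prime $p$ and all $a,b\in A$ with $\mathcal O(0,a,b)$ there is $c\in A$ with $\mathcal O(a,pc,b)$ and $ic<_0(i+1)c$ for $1\le i\le p-1$. For a prime $p$ let $[p]A=|A/pA|$, and let $e(A,p)\in\mathbb N\cup\{\infty\}$ be the least $e$ with $\{x: p^{e+k}x=0\}=\{x:p^{e}x=0\}$ for all $k\in\mathbb N$, or $\infty$ if there is no such $e$. For sequences $\vec d=(d_p)_p$, $\vec e=(e_p)_p$ in $\mathbb N\cup\{\infty\}$ indexed by the primes, the models of $T(\vec d,\vec e)$ are the regularly dense oriented abelian groups $A$ with $[p]A=p^{d_p}$ and $e(A,p)=e_p$ for every prime $p$. The models of $T((\vec d_1,\vec e_1),(\vec d_2,\vec e_2))$ are the pairs $(A,G)$,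 viewed as structures in the language $\{+,-,0,\mathcal O,V\}$ with $V$ interpreted as $G$, where $A\models T(\vec d_1,\vec e_1)$, $G$ is a subgroup of $A$ which with the induced orientation is a model of $T(\vec d_2,\vec e_2)$, $G$ is dense in $A$ (it meets every nonempty orientation interval $(a,b)_{\mathcal O}=\{x:\mathcal O(a,x,b)\}$), and $A/G$ is infinite. For a structure $M$ and a partitioned first-order formula $\psi(\vec x;\vec y)$ with $|\vec x|=m$, $|\vec y|=n$, let $\pi_\psi(t)$ be the maximum, over the $t$-element subsets $B$ of $M^m$, of the number of sets $B\cap\psi(M;\vec b)$ with $\vec b\in M^n$, where $\psi(M;\vec b)=\{\vec a\in M^m: M\models\psi(\vec a;\vec b)\}$. The \emph{VC-density} of $\psi$ in $M$ is the infimum of the real numbers $r\ge 0$ with $\pi_\psi(t)=O(t^r)$ as $t\to\infty$ ($\infty$ if there are none). \textbf{Corollary.} Let $(A,G)$ be a model of $T((\vec 0,\vec 0),(\vec 0,\vec 0))$ or of $T((\vec 0,\vec\infty),(\vec 0,\vec e))$ with $\vec e\in\{\vec 0,\vec\infty\}$, where $\vec 0$ and $\vec\infty$ are the constant sequences. Then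 every partitioned formula $\psi(\vec x;\vec y)$ in the language $\{+,-,0,\mathcal O,V\}$ has VC-density at most $2|\vec y|$ in $(A,G)$. -/

import Mathlib

open FirstOrder Asymptotics Filter
open scoped NNReal ENNReal

/-! ### Oriented abelian groups -/

/-- An oriented abelian group: an abelian group with a cyclic, translation invariant ternary
relation `ori` such that `x <₀ y :↔ x ≠ y ∧ ori 0 x y` is a strict linear order on the nonzero
elements (and relates nonzero elements only). -/
class OrientedAddCommGroup (A : Type*) extends AddCommGroup A where
  ori : A → A → A → Prop
  ori_cyclic : ∀ x y z, ori x y z → ori y z x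
  ori_add : ∀ x y z w, ori x y z → ori (x + w) (y + w) (z + w)
  ori_zero_ne : ∀ x y, ori 0 x y → x ≠ 0 ∧ y ≠ 0 ∧ x ≠ y
  ori_zero_trans : ∀ x y z, ori 0 x y → ori 0 y z → ori 0 x z
  ori_zero_total : ∀ x y, x ≠ 0 → y ≠ 0 → x ≠ y → ori 0 x y ∨ ori 0 y x

namespace OrientedAddCommGroup

/-- A subgroup of an oriented abelian group, with the induced orientation. -/
instance {A : Type*} [OrientedAddCommGroup A] (G : AddSubgroup A) : OrientedAddCommGroup G where
  ori x y z := ori (x : A) (y : A) (z : A)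
  ori_cyclic _ _ _ h := ori_cyclic _ _ _ h
  ori_add _ _ _ w h := ori_add _ _ _ (w : A) h
  ori_zero_ne x y h := by
    obtain ⟨h1, h2, h3⟩ := ori_zero_ne (x : A) (y : A) h
    exact ⟨fun e => h1 (congrArg Subtype.val e), fun e => h2 (congrArg Subtype.val e),
      fun e => h3 (congrArg Subtype.val e)⟩
  ori_zero_trans _ _ _ h h' := ori_zero_trans _ _ _ h h'
  ori_zero_total x y hx hy h :=
    ori_zero_total (x : A) (y : A) (fun e => hx (Subtype.ext e)) (fun e => hy (Subtype.ext e))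
      (fun e => h (Subtype.ext e))

variable (A : Type*) [OrientedAddCommGroup A]

/-- Regular density: for every prime `p`, whenever `O(0,a,b)` there is `c` with `O(a,pc,b)` and
`c <₀ 2c <₀ ⋯ <₀ pc`. -/
def RegularlyDense : Prop :=
  ∀ p : ℕ, p.Prime → ∀ a b : A, ori 0 a b →
    ∃ c : A, ori a (p • c) b ∧ ∀ i : ℕ, 1 ≤ i → i < p → ori 0 (i • c) ((i + 1) • c)

/-- `[p]A`, the cardinality of `A / pA`, as an extended natural number. -/
noncomputable def primeIndex (p : ℕ) : ℕ∞ :=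
  ENat.card (A ⧸ (nsmulAddMonoidHom p : A →+ A).range)

/-- `e(A,p)`: the least `e` at which the chain `Tor_{p^0}(A) ≤ Tor_{p^1}(A) ≤ ⋯` becomes
stationary, where `Tor_n(A) = {x | n x = 0}`, and `∞` if the chain does not terminate. -/
noncomputable def torsionExponent (p : ℕ) : ℕ∞ :=
  sInf {e : ℕ∞ | ∃ n : ℕ, e = n ∧
    ∀ k : ℕ, {x : A | p ^ (n + k) • x = 0} = {x : A | p ^ n • x = 0}}

/-- `A` is a model of the theory `T(d,e)`, for sequences `d`, `e` indexed by the primes: `A` is a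
regularly dense oriented abelian group with `[p]A = p ^ d(p)` and `e(A,p) = e(p)` for every
prime `p`. -/
structure IsModel (d e : Nat.Primes → ℕ∞) : Prop where
  regularlyDense : RegularlyDense A
  primeIndex_eq : ∀ p : Nat.Primes, primeIndex A p = ((p : ℕ) : ℕ∞) ^ d p
  torsionExponent_eq : ∀ p : Nat.Primes, torsionExponent A p = e p

variable {A}

/-- `(A, G)` is a model of the theory `T((d₁,e₁),(d₂,e₂))` of pairs: `A` is a model of `T(d₁,e₁)`,
`G` is a model of `T(d₂,e₂)` with the induced orientation, `G` is dense in `A` (it meets every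
nonempty orientation interval `(a,b)`), and `A / G` is infinite. -/
structure IsPairModel (d₁ e₁ d₂ e₂ : Nat.Primes → ℕ∞) (G : AddSubgroup A) : Prop where
  isModel : IsModel A d₁ e₁
  isModel_subgroup : IsModel G d₂ e₂
  dense : ∀ a x b : A, ori a x b → ∃ g ∈ G, ori a g b
  infinite_quotient : Infinite (A ⧸ G)

end OrientedAddCommGroup

/-! ### The language of pairs of oriented abelian groups -/

/-- The function symbols `0`, `-`, `+`. -/
inductive OriPairFunc : ℕ → Type
  | zero : OriPairFunc 0
  | neg : OriPairFunc 1
  | add : OriPairFunc 2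

/-- The relation symbols: the ternary `O` and the unary `V`. -/
inductive OriPairRel : ℕ → Type
  | ori : OriPairRel 3
  | sub : OriPairRel 1

/-- The language `{+, -, 0, O, V}` of pairs of oriented abelian groups. -/
def oriPairLanguage : Language where
  Functions := OriPairFunc
  Relations := OriPairRel

/-- The pair `(A, G)` as a first-order structure; `V` is interpreted as `G`. -/
@[reducible] def oriPairStructure {A : Type*} [OrientedAddCommGroup A] (G : AddSubgroup A) :
    oriPairLanguage.Structure A where
  funMap f v := match f with
    | OriPairFunc.zero => 0
    | OriPairFunc.neg => - v 0
    | OriPairFunc.add => v 0 + v 1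
  RelMap r v := match r with
    | OriPairRel.ori => OrientedAddCommGroup.ori (v 0) (v 1) (v 2)
    | OriPairRel.sub => v 0 ∈ G

/-! ### VC-density -/

/-- The shatter function of a family `S` of subsets of `X`: the maximum, over the `t`-element
subsets `B` of `X`, of the number of subsets of `B` of the form `B ∩ s` with `s ∈ S`. -/
noncomputable def shatterFunction {X : Type*} (S : Set (Set X)) (t : ℕ) : ℕ :=
  sSup {k | ∃ B : Finset X, B.card = t ∧ k = ((fun s => (B : Set X) ∩ s) '' S).ncard}

/-- The supremum defining the shatter function is over a bounded set. -/
theorem shatterFunction_bddAbove {X : Type*} (S : Set (Set X)) (t : ℕ) :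
    BddAbove {k | ∃ B : Finset X, B.card = t ∧ k = ((fun s => (B : Set X) ∩ s) '' S).ncard} := by
  refine ⟨2 ^ t, ?_⟩
  rintro k ⟨B, hB, rfl⟩
  have h : ((fun s => (B : Set X) ∩ s) '' S) ⊆ Set.powerset (B : Set X) := by
    rintro _ ⟨s, -, rfl⟩
    exact Set.inter_subset_left
  refine (Set.ncard_le_ncard h B.finite_toSet.powerset).trans ?_
  rw [Set.ncard_powerset _ B.finite_toSet, Set.ncard_coe_finset, hB]

/-- The family of the sets `ψ(M;b) ⊆ M^m`, `b ∈ M^n`, for a partitioned formula `ψ(x;y)` with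
`|x| = m` and `|y| = n`. -/
def definableFamily {L : Language} (M : Type*) [L.Structure M] {m n : ℕ}
    (ψ : L.Formula (Fin m ⊕ Fin n)) : Set (Set (Fin m → M)) :=
  Set.range fun b : Fin n → M => {a : Fin m → M | ψ.Realize (Sum.elim a b)}

/-- The VC-density of a partitioned formula in the structure `M`: the infimum of the real `r ≥ 0`
with `π_ψ(t) = O(t ^ r)` (and `∞` if there is none). -/
noncomputable def vcDensity {L : Language} (M : Type*) [L.Structure M] {m n : ℕ}
    (ψ : L.Formula (Fin m ⊕ Fin n)) : ℝ≥0∞ :=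
  ⨅ (r : ℝ≥0) (_ : (fun t : ℕ => (shatterFunction (definableFamily M ψ) t : ℝ)) =O[atTop]
    fun t : ℕ => (t : ℝ) ^ (r : ℝ)), (r : ℝ≥0∞)

/-! ### Dense pairs of ordered abelian groups and back-and-forth -/

/-! An oriented group `A` is the quotient of a linearly ordered group `H`, its unwinding, by an
infinite cyclic cofinal subgroup generated by a full turn `u`. Elements of `A` are represented in
`[0, u)`, and orientation is the cyclic order of representatives. Let `K` be the preimage of `G`.
Divisibility of `A` and `G` makes `H / dH` and `K / dK` generated by `u`; regular density makes
every `dK` dense; and `H / K` is infinite. These properties form `DensePair`.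

In a dense pair a back-and-forth argument (`DensePair.exists_sameKind`) shows that the type of a
tuple is governed by positivity and membership in `dK` and `dH` of integer combinations of `u` and
the tuple. The bounds are kept explicit: each quantifier consumes a larger bound on coefficients and
on `d`, so a fixed formula depends on finitely many conditions (`exists_agree_realize_iff`). No
saturation is needed.

For `t` points and a parameter `b` of length `n` it remains to count patterns of `s = O(t)` affine
functions of the lifts of `b`. Signs give at most `(s + 1) ^ n` patterns, by Sauer-Shelah, since `n
+ 1` coefficient vectors in `ℤ ^ n` are dependent. Membership in the `dK` gives `O(s ^ n)` patterns,
since at most `n` residues determine the pattern. Membership in the `dH` depends only on the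
residues of the `b j`, which contribute a constant factor. The product is `O(t ^ (2 n))`. -/

/-- `multiples K d` is the subgroup `d K`. -/
def multiples {H : Type*} [AddCommGroup H] (K : AddSubgroup H) (d : ℕ) : AddSubgroup H :=
  K.map (nsmulAddMonoidHom d)

theorem mem_multiples {H : Type*} [AddCommGroup H] {K : AddSubgroup H} {d : ℕ} {x : H} :
    x ∈ multiples K d ↔ ∃ g ∈ K, d • g = x := by
  simp [multiples, AddSubgroup.mem_map]

theorem mem_multiples_top {H : Type*} [AddCommGroup H] {d : ℕ} {x : H} :
    x ∈ multiples (⊤ : AddSubgroup H) d ↔ ∃ g, d • g = x := by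
  simp [mem_multiples]

theorem multiples_le {H : Type*} [AddCommGroup H] (K : AddSubgroup H) (d : ℕ) :
    multiples K d ≤ K := by
  intro x hx
  obtain ⟨g, hg, rfl⟩ := mem_multiples.1 hx
  exact K.nsmul_mem hg d

theorem multiples_one {H : Type*} [AddCommGroup H] (K : AddSubgroup H) : multiples K 1 = K := by
  ext x; simp [mem_multiples]

theorem multiples_mono_left {H : Type*} [AddCommGroup H] {K K' : AddSubgroup H} (h : K ≤ K')
    (d : ℕ) : multiples K d ≤ multiples K' d :=
  AddSubgroup.map_mono h

theorem nsmul_mem_multiples_of_dvd {H : Type*} [AddCommGroup H] {K : AddSubgroup H} {d D : ℕ}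
    (h : d ∣ D) {g : H} (hg : g ∈ K) : D • g ∈ multiples K d := by
  obtain ⟨k, rfl⟩ := h
  exact mem_multiples.2 ⟨k • g, K.nsmul_mem hg k, (mul_nsmul' g d k).symm⟩

theorem multiples_le_of_dvd {H : Type*} [AddCommGroup H] (K : AddSubgroup H) {d D : ℕ}
    (h : d ∣ D) : multiples K D ≤ multiples K d := by
  intro x hx
  obtain ⟨g, hg, rfl⟩ := mem_multiples.1 hx
  exact nsmul_mem_multiples_of_dvd h hg

theorem nsmul_mem_multiples_mul_iff {H : Type*} [AddCommGroup H] [IsAddTorsionFree H]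
    {K : AddSubgroup H} {b d : ℕ} (hb : b ≠ 0) {x : H} :
    b • x ∈ multiples K (b * d) ↔ x ∈ multiples K d := by
  simp only [mem_multiples, mul_nsmul']
  refine exists_congr fun g => and_congr_right fun _ => ?_
  exact (nsmul_right_injective (M := H) hb).eq_iff

/-- A linearly ordered abelian group `H` with a dense subgroup `K` and a positive `u ∈ K`, such
that `H / dH` and `K / dK` are generated by `u`, all `dK` are dense, and `H / K` is infinite. -/
structure DensePair {H : Type*} [AddCommGroup H] [LinearOrder H] (K : AddSubgroup H) (u : H) :
    Prop where
  pos : 0 < u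
  mem : u ∈ K
  div : ∀ d : ℕ, 0 < d → ∀ x : H, ∃ y : H, ∃ j : ℕ, j < d ∧ x = d • y + j • u
  div_mem : ∀ d : ℕ, 0 < d → ∀ x ∈ K, ∃ y ∈ K, ∃ j : ℕ, j < d ∧ x = d • y + j • u
  dense : ∀ d : ℕ, 0 < d → ∀ x y : H, x < y → ∃ g ∈ K, x < d • g ∧ d • g < y
  infinite : Infinite (H ⧸ K)

/-- The elements `f` and `g` satisfy the same conditions `f ∈ dK` and `f ∈ dH`, `d ≤ N`. -/
def SameClass {H : Type*} [AddCommGroup H] (K : AddSubgroup H) (N : ℕ) (f g : H) : Prop :=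
  ∀ d : ℕ, 0 < d → d ≤ N → (f ∈ multiples K d ↔ g ∈ multiples K d) ∧
    (f ∈ multiples (⊤ : AddSubgroup H) d ↔ g ∈ multiples (⊤ : AddSubgroup H) d)

/-- The elements `f` and `g` have the same positivity and satisfy `SameClass`. -/
def SameKind {H : Type*} [AddCommGroup H] [LinearOrder H] (K : AddSubgroup H) (N : ℕ)
    (f g : H) : Prop :=
  (0 < f ↔ 0 < g) ∧ SameClass K N f g

/-- The integer vectors with entries of absolute value at most `N`. -/
def intBox (ι : Type*) (N : ℕ) : Set (ι → ℤ) := {l | ∀ i, |l i| ≤ N}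

/-- Two tuples, given by their homomorphisms of linear combinations, have the same conditions with
coefficients bounded by `N`. -/
def Agree {H : Type*} [AddCommGroup H] [LinearOrder H] (K : AddSubgroup H) (N : ℕ)
    {ι : Type*} (e e' : (ι → ℤ) →+ H) : Prop :=
  ∀ l ∈ intBox ι N, SameKind K N (e l) (e' l)

/-! ### Boxes of bounded coefficient vectors. -/

section Box

variable {ι : Type*} {N M : ℕ} {l k : ι → ℤ}

theorem intBox_mono (h : N ≤ M) : intBox ι N ⊆ intBox ι M := fun _ hl i =>
  (hl i).trans (by exact_mod_cast h)

theorem neg_mem_intBox (hl : l ∈ intBox ι N) : -l ∈ intBox ι N := fun i => by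
  simpa using hl i

theorem add_mem_intBox (hl : l ∈ intBox ι N) (hk : k ∈ intBox ι M) : l + k ∈ intBox ι (N + M) :=
  fun i => by
    have := abs_add_le (l i) (k i)
    have h1 := hl i
    have h2 := hk i
    push_cast
    simp only [Pi.add_apply]
    linarith

theorem zsmul_mem_intBox {b : ℤ} (hb : |b| ≤ M) (hl : l ∈ intBox ι N) :
    b • l ∈ intBox ι (M * N) := fun i => by
  have h1 := hl i
  simp only [Pi.smul_apply, smul_eq_mul, abs_mul]
  push_cast
  exact mul_le_mul hb h1 (abs_nonneg _) (by positivity)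

theorem nsmul_mem_intBox {b : ℕ} (hb : b ≤ M) (hl : l ∈ intBox ι N) :
    b • l ∈ intBox ι (M * N) := by
  rw [← natCast_zsmul]
  exact zsmul_mem_intBox (by simpa using hb) hl

theorem intBox_finite [Finite ι] (N : ℕ) : (intBox ι N).Finite := by
  have : intBox ι N = Set.pi Set.univ fun _ => Set.Icc (-(N : ℤ)) N := by
    ext l; simp only [intBox, Set.mem_ofPred_eq, abs_le, Set.mem_pi, Set.mem_univ, forall_const,
      Set.mem_Icc]
  rw [this]
  exact Set.Finite.pi fun _ => Set.finite_Icc _ _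

end Box

namespace SameKind

variable {H : Type*} [AddCommGroup H] [LinearOrder H] {K : AddSubgroup H}
  {N M : ℕ} {f g : H}

theorem mono (h : N ≤ M) (hs : SameKind K M f g) : SameKind K N f g :=
  ⟨hs.1, fun d h0 hd => hs.2 d h0 (hd.trans h)⟩

/-- In a torsion-free group, `b • f ∈ (b d) K` cancels to `f ∈ d K`. The conditions on `f` are thus
read off from its multiple at the cost of a factor `b` in the bound. -/
theorem of_nsmul [IsOrderedAddMonoid H] {b : ℕ} (hb : 0 < b) (h : SameKind K (b * N) (b • f) (b • g)) :
    SameKind K N f g := by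
  refine ⟨by simpa [nsmul_pos_iff hb.ne'] using h.1, fun d h0 hd => ?_⟩
  have := h.2 (b * d) (Nat.mul_pos hb h0) (Nat.mul_le_mul_left b hd)
  simpa only [nsmul_mem_multiples_mul_iff hb.ne'] using this

end SameKind

/-! ### The back-and-forth step in a dense pair. -/

namespace DensePair

variable {H : Type*} [AddCommGroup H] [LinearOrder H] [IsOrderedAddMonoid H] {K : AddSubgroup H}
  {u : H}

/-- If `b x` is a linear combination of the first tuple then a corresponding element exists for the
second tuple. -/
theorem exists_sameKind_of_nsmul_eq {ι : Type*} {N N₁ N' b : ℕ} (hb : 0 < b) (hbN : b ≤ N)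
    (hN' : N * N + N * N₁ + N₁ ≤ N') {e e' : (ι → ℤ) →+ H} (he : Agree K N' e e')
    {a : ι → ℤ} (ha : a ∈ intBox ι N₁) {x : H} (hx : b • x = e a) :
    ∃ x', ∀ l ∈ intBox ι N, ∀ k : ℤ, |k| ≤ N → SameKind K N (e l + k • x) (e' l + k • x') := by
  have hNN : N ≤ N * N := by nlinarith
  -- Divisibility of `e a` by `b` is one of the conditions that agree, so `e' a` can be divided too;
  -- the quotient is the required element.
  have h1 : e' a ∈ multiples (⊤ : AddSubgroup H) b := by
    rw [← ((he a (intBox_mono (by omega) ha)).2 b hb (by omega)).2]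
    exact mem_multiples_top.2 ⟨x, hx⟩
  obtain ⟨x', hx'⟩ := mem_multiples_top.1 h1
  refine ⟨x', fun l hl k hk => SameKind.of_nsmul hb ?_⟩
  have hmem : b • l + k • a ∈ intBox ι N' :=
    intBox_mono (by omega) (add_mem_intBox (nsmul_mem_intBox hbN hl) (zsmul_mem_intBox hk ha))
  have := (he _ hmem).mono (N := b * N) ((Nat.mul_le_mul_right N hbN).trans (by omega))
  have h2 : ∀ (e : (ι → ℤ) →+ H) (x : H), b • x = e a →
      b • (e l + k • x) = e (b • l + k • a) := fun e x hx => by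
    rw [map_add, map_nsmul, map_zsmul, ← hx, nsmul_add, smul_comm]
  rwa [h2 e x hx, h2 e' x' hx']

/-- If `n • x ∈ K`, division in `K` gives `n • (x - g) = j • u` with `g ∈ K` and `j < n`. Each such
equation has at most one solution in `H`, so there are at most `n` torsion classes. -/
theorem finite_torsion (P : DensePair K u) {n : ℕ} (hn : 0 < n) :
    {q : H ⧸ K | n • q = 0}.Finite := by
  have h1 : (⋃ j ∈ Finset.range n, {y : H | n • y = j • u}).Finite := by
    refine Set.Finite.biUnion (Finset.finite_toSet _) fun j _ => Set.Subsingleton.finite ?_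
    intro y hy z hz
    exact nsmul_right_injective (M := H) hn.ne' (hy.trans hz.symm)
  refine (h1.image (QuotientAddGroup.mk (s := K))).subset fun q hq => ?_
  obtain ⟨x, rfl⟩ := QuotientAddGroup.mk_surjective q
  have hx : n • x ∈ K := by
    rw [← QuotientAddGroup.eq_zero_iff]; exact hq
  obtain ⟨g, hg, j, hj, he⟩ := P.div_mem n hn _ hx
  refine ⟨x - g, ?_, ?_⟩
  · simp only [Finset.mem_range, Set.mem_iUnion]
    exact ⟨j, hj, by simp [nsmul_sub, he]⟩
  · rw [QuotientAddGroup.eq]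
    simpa using hg

theorem finite_fiber (P : DensePair K u) {n : ℤ} (hn : n ≠ 0) (w : H) :
    {q : H ⧸ K | n • q = w}.Finite := by
  rcases Set.eq_empty_or_nonempty {q : H ⧸ K | n • q = w} with h | ⟨q₀, hq₀⟩
  · rw [h]; exact Set.finite_empty
  refine ((P.finite_torsion (Int.natAbs_pos.2 hn)).image (q₀ + ·)).subset fun q hq => ?_
  refine ⟨q - q₀, ?_, by simp⟩
  have h : n • (q - q₀) = 0 := by
    rw [zsmul_sub, show n • q = w from hq, show n • q₀ = w from hq₀, sub_self]
  show n.natAbs • (q - q₀) = 0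
  rcases Int.natAbs_eq n with h' | h'
  · rw [h', natCast_zsmul] at h; simpa using h
  · rw [h', neg_smul, natCast_zsmul, neg_eq_zero] at h; simpa using h

/-- Finitely many conditions `k x + w ∉ K` with `k ≠ 0` have a common solution. -/
theorem exists_forall_notMem (P : DensePair K u) {S : Set (ℤ × H)} (hS : S.Finite)
    (h0 : ∀ s ∈ S, s.1 ≠ 0) : ∃ x : H, ∀ s ∈ S, s.2 + s.1 • x ∉ K := by
  have hf : (⋃ s ∈ S, {q : H ⧸ K | s.1 • q = (-s.2 : H)}).Finite :=
    hS.biUnion fun s hs => P.finite_fiber (h0 s hs) _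
  have := P.infinite
  obtain ⟨q, hq⟩ := hf.infinite_compl.nonempty
  obtain ⟨x, rfl⟩ := QuotientAddGroup.mk_surjective q
  refine ⟨x, fun s hs hx => hq ?_⟩
  simp only [Set.mem_iUnion]
  refine ⟨s, hs, ?_⟩
  show s.1 • (x : H ⧸ K) = ((-s.2 : H) : H ⧸ K)
  rw [← QuotientAddGroup.mk_zsmul, eq_comm, QuotientAddGroup.eq]
  simpa using hx

/-- The classes of an element over the first tuple can be matched over the second tuple. -/
theorem exists_sameClass (P : DensePair K u) {ι : Type*} [Finite ι] {N N' : ℕ}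
    (hN' : N * N + N * (N * N.factorial + N) + (N * N.factorial + N) ≤ N')
    {e e' : (ι → ℤ) →+ H} (he : Agree K N' e e') {c : ι → ℤ} (hc : c ∈ intBox ι 1)
    (hec : e c = u) (hec' : e' c = u) (x : H) :
    ∃ x', ∀ l ∈ intBox ι N, ∀ k : ℤ, |k| ≤ N → SameClass K N (e l + k • x) (e' l + k • x') := by
  have hD : 0 < N.factorial := N.factorial_pos
  -- Either `x` is algebraic over the first tuple modulo `K`, with bounded coefficients, or no
  -- bounded combination involving `x` lies in `K`.
  by_cases h : ∃ a ∈ intBox ι N, ∃ b : ℕ, 0 < b ∧ b ≤ N ∧ e a + b • x ∈ K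
  · obtain ⟨a, ha, b, hb, hbN, hab⟩ := h
    -- Dividing by `b * N.factorial` makes `b • (x - N.factorial • g)` a combination of the tuple,
    -- while subtracting `N.factorial • g` changes no class modulo `dK` or `dH` with `d ≤ N`.
    obtain ⟨g, hg, j, hj, hgj⟩ := P.div_mem (b * N.factorial) (Nat.mul_pos hb hD) _ hab
    have hy : b • (x - N.factorial • g) = e (j • c + -a) := by
      rw [map_add, map_nsmul, map_neg, hec, nsmul_sub, ← mul_nsmul']
      rw [eq_comm, ← sub_eq_iff_eq_add'] at hgj
      rw [← hgj]; abel
    have hmem : j • c + -a ∈ intBox ι (N * N.factorial + N) := by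
      refine add_mem_intBox ?_ (neg_mem_intBox ha)
      have := nsmul_mem_intBox (M := N * N.factorial)
        (hj.le.trans (Nat.mul_le_mul_right _ hbN)) hc
      simpa using this
    obtain ⟨x', hx'⟩ := exists_sameKind_of_nsmul_eq hb hbN hN' he hmem hy
    refine ⟨x', fun l hl k hk d h0 hd => ?_⟩
    have hdD : d ∣ N.factorial := Nat.dvd_factorial h0 hd
    have key := (hx' l hl k hk).2 d h0 hd
    have hg' : k • N.factorial • g ∈ multiples K d :=
      zsmul_mem (nsmul_mem_multiples_of_dvd hdD hg) k
    have heq : e l + k • x = e l + k • (x - N.factorial • g) + k • N.factorial • g := by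
      rw [zsmul_sub]; abel
    rw [heq, add_mem_cancel_right hg', add_mem_cancel_right (multiples_mono_left le_top d hg')]
    exact key
  · push Not at h
    obtain ⟨y, j, hj, hxy⟩ := P.div N.factorial hD x
    let S : Set (ℤ × H) := (fun p : (ι → ℤ) × ℤ =>
      (p.2 * N.factorial, e' p.1 + (p.2 * j) • u)) ''
        (intBox ι N ×ˢ (Set.Icc (-(N : ℤ)) N \ {0}))
    have hS : S.Finite :=
      ((intBox_finite N).prod ((Set.finite_Icc _ _).subset Set.sdiff_subset)).image _
    -- The new element keeps the residue `j • u` of `x`, which fixes all classes modulo `dH`. Its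
    -- free part `N.factorial • z` is chosen generic, so no bounded combination involving it lies in
    -- `K`.
    obtain ⟨z, hz⟩ := P.exists_forall_notMem hS (by
      rintro _ ⟨p, ⟨-, -, hp⟩, rfl⟩
      exact mul_ne_zero hp (by exact_mod_cast hD.ne'))
    have hxK : ∀ l ∈ intBox ι N, ∀ k : ℤ, k ≠ 0 → |k| ≤ N → e l + k • x ∉ K := by
      intro l hl k hk0 hk hmem
      have hkN : k.natAbs ≤ N := by rw [Int.abs_eq_natAbs] at hk; exact_mod_cast hk
      rcases Int.natAbs_eq k with h' | h'
      · refine h l hl k.natAbs (Int.natAbs_pos.2 hk0) hkN ?_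
        rw [h', natCast_zsmul] at hmem; exact hmem
      · refine h (-l) (neg_mem_intBox hl) k.natAbs (Int.natAbs_pos.2 hk0) hkN ?_
        rw [h', ← neg_mem_iff] at hmem
        simp only [map_neg]
        convert hmem using 1
        rw [neg_smul, natCast_zsmul]; abel
    refine ⟨N.factorial • z + j • u, fun l hl k hk d h0 hd => ⟨?_, ?_⟩⟩
    · rcases eq_or_ne k 0 with rfl | hk0
      · simpa using ((he l (intBox_mono (by nlinarith) hl)).2 d h0 (by nlinarith)).1
      · refine iff_of_false (fun h => hxK l hl k hk0 hk (multiples_le K d h))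
          (fun h => hz _ ⟨(l, k), ⟨hl, by simpa [abs_le] using hk, hk0⟩, rfl⟩ ?_)
        have := multiples_le K d h
        convert this using 1
        simp only [zsmul_add, mul_smul, natCast_zsmul]
        abel
    · have hdD : d ∣ N.factorial := Nat.dvd_factorial h0 hd
      have hmem : l + (k * j) • c ∈ intBox ι N' := by
        have h1 : |k * j| ≤ ((N * N.factorial : ℕ) : ℤ) := by
          rw [abs_mul]
          push_cast
          refine mul_le_mul hk ?_ (abs_nonneg _) (by positivity)
          rw [Nat.abs_cast]; exact_mod_cast hj.le
        refine intBox_mono ?_ (add_mem_intBox hl (zsmul_mem_intBox h1 hc))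
        omega
      have key := ((he _ hmem).2 d h0 (by nlinarith)).2
      have h3 : ∀ v w : H, v + k • (N.factorial • w + j • u) ∈ multiples (⊤ : AddSubgroup H) d ↔
          v + (k * j) • u ∈ multiples (⊤ : AddSubgroup H) d := by
        intro v w
        have hw : k • N.factorial • w ∈ multiples (⊤ : AddSubgroup H) d :=
          zsmul_mem (nsmul_mem_multiples_of_dvd hdD (AddSubgroup.mem_top w)) k
        rw [zsmul_add, add_left_comm, add_mem_cancel_left hw, mul_smul, natCast_zsmul]
      rw [hxy, h3, h3]
      simpa only [map_add, map_zsmul, hec, hec'] using key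

/-- Some element of `x + dK` lies in a given cut of finite sets. -/
theorem exists_between_finite (P : DensePair K u) {d : ℕ} (hd : 0 < d) {S T : Set H}
    (hS : S.Finite) (hT : T.Finite) (hST : ∀ s ∈ S, ∀ t ∈ T, s < t) (x : H) :
    ∃ g ∈ K, (∀ s ∈ S, s < x + d • g) ∧ ∀ t ∈ T, x + d • g < t := by
  obtain ⟨s, t, hs, ht, hst⟩ : ∃ s t : H, (∀ a ∈ S, a ≤ s) ∧ (∀ b ∈ T, t ≤ b) ∧ s < t := by
    rcases S.eq_empty_or_nonempty with rfl | hS'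
    · rcases T.eq_empty_or_nonempty with rfl | hT'
      · exact ⟨0, u, by simp, by simp, P.pos⟩
      · obtain ⟨t, htT, ht⟩ := Set.exists_min_image T id hT hT'
        exact ⟨t - u, t, by simp, ht, sub_lt_self t P.pos⟩
    · obtain ⟨s, hsS, hs⟩ := Set.exists_max_image S id hS hS'
      rcases T.eq_empty_or_nonempty with rfl | hT'
      · exact ⟨s, s + u, hs, by simp, lt_add_of_pos_right s P.pos⟩
      · obtain ⟨t, htT, ht⟩ := Set.exists_min_image T id hT hT'
        exact ⟨s, t, hs, ht, hST s hsS t htT⟩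
  obtain ⟨g, hg, h1, h2⟩ := P.dense d hd (s - x) (t - x) (sub_lt_sub_right hst x)
  exact ⟨g, hg, fun a ha => (hs a ha).trans_lt (sub_lt_iff_lt_add'.1 h1),
    fun b hb => (lt_sub_iff_add_lt'.1 h2).trans_le (ht b hb)⟩

/-- One step of back-and-forth. -/
theorem exists_sameKind (P : DensePair K u) {ι : Type*} [Finite ι] (N : ℕ) :
    ∃ N', ∀ e e' : (ι → ℤ) →+ H, Agree K N' e e' → ∀ c ∈ intBox ι 1, e c = u → e' c = u →
      ∀ x, ∃ x', ∀ l ∈ intBox ι N, ∀ k : ℤ, |k| ≤ N →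
        SameKind K N (e l + k • x) (e' l + k • x') := by
  set D := N.factorial with hDdef
  have hD : 0 < D := N.factorial_pos
  -- The first three summands serve `exists_sameClass`; the last permits comparing two vectors of
  -- `intBox ι (D * N)`.
  refine ⟨N * N + N * (N * D + N) + (N * D + N) + (D * N + D * N),
    fun e e' he c hc hec hec' x => ?_⟩
  by_cases h : ∃ a ∈ intBox ι N, ∃ b : ℕ, 0 < b ∧ b ≤ N ∧ e a + b • x = 0
  · obtain ⟨a, ha, b, hb, hbN, hab⟩ := h
    refine exists_sameKind_of_nsmul_eq (N₁ := N) hb hbN ?_ he (neg_mem_intBox ha) (x := x) ?_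
    · nlinarith
    · rw [map_neg]; exact eq_neg_of_add_eq_zero_right hab
  push Not at h
  obtain ⟨x₀, hx₀⟩ := P.exists_sameClass (N := N) (Nat.le_add_right _ _) he hc hec hec' x
  have hbox : intBox ι (D * N) ⊆
      intBox ι (N * N + N * (N * D + N) + (N * D + N) + (D * N + D * N)) :=
    intBox_mono (by omega)
  -- A comparison of `b • x` with the tuple becomes one of `D • x` after multiplication by `D / b`,
  -- so a single cut suffices. The factor `D * D` makes the corrected point `D • (x₀ + D • g)`, and
  -- `D • g` preserves the classes found for `x₀`.
  obtain ⟨g, hg, hlow, hup⟩ := P.exists_between_finite (Nat.mul_pos hD hD)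
    (S := e' '' {r | r ∈ intBox ι (D * N) ∧ e r < D • x})
    (T := e' '' {r | r ∈ intBox ι (D * N) ∧ D • x < e r})
    (((intBox_finite _).subset fun _ hr => hr.1).image _)
    (((intBox_finite _).subset fun _ hr => hr.1).image _)
    (by
      rintro _ ⟨r, ⟨hr, hrx⟩, rfl⟩ _ ⟨s, ⟨hs, hsx⟩, rfl⟩
      have h1 := (he (s + -r) (intBox_mono (by omega)
        (add_mem_intBox hs (neg_mem_intBox hr)))).1
      rw [map_add, map_add, map_neg, map_neg, ← sub_eq_add_neg, ← sub_eq_add_neg, sub_pos,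
        sub_pos] at h1
      exact h1.1 (hrx.trans hsx)) (D • x₀)
  set x' := x₀ + D • g with hx'
  have hDx' : D • x₀ + (D * D) • g = D • x' := by rw [hx', nsmul_add, mul_nsmul']
  rw [hDx'] at hlow hup
  -- Nonvanishing is carried along because `SameKind` records only positivity: negative coefficients
  -- of `x` require excluding zero before negating.
  have hpos : ∀ l ∈ intBox ι N, ∀ b : ℕ, 0 < b → b ≤ N →
      ((0 < e l + b • x ↔ 0 < e' l + b • x') ∧ e' l + b • x' ≠ 0) := by
    intro l hl b hb hbN
    obtain ⟨q, hq⟩ : b ∣ D := Nat.dvd_factorial hb hbN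
    have hq0 : q ≠ 0 := by rintro rfl; simp at hq; omega
    have hqD : q ≤ D := by rw [hq]; exact Nat.le_mul_of_pos_left q hb
    have hr : -(q • l) ∈ intBox ι (D * N) := neg_mem_intBox (nsmul_mem_intBox hqD hl)
    have hmul : ∀ (e : (ι → ℤ) →+ H) (x : H), q • (e l + b • x) = D • x - e (-(q • l)) := by
      intro e x
      rw [nsmul_add, ← mul_nsmul, ← hq, map_neg, map_nsmul]; abel
    have hne : e (-(q • l)) ≠ D • x := by
      intro heq
      have h1 := hmul e x
      rw [heq, sub_self] at h1
      exact h l hl b hb hbN ((nsmul_right_injective (M := H) hq0) (by simpa using h1))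
    rw [← nsmul_pos_iff hq0, hmul, sub_pos, ← nsmul_pos_iff hq0 (x := e' l + b • x'), hmul, sub_pos]
    have hz : e' l + b • x' = 0 → D • x' = e' (-(q • l)) := by
      intro h0
      have := hmul e' x'
      rw [h0, nsmul_zero] at this
      exact sub_eq_zero.1 this.symm
    rcases hne.lt_or_gt with hlt | hlt
    · have := hlow _ ⟨_, ⟨hr, hlt⟩, rfl⟩
      exact ⟨iff_of_true hlt this, fun h0 => this.ne (hz h0).symm⟩
    · have := hup _ ⟨_, ⟨hr, hlt⟩, rfl⟩
      exact ⟨iff_of_false hlt.not_gt this.not_gt, fun h0 => this.ne (hz h0)⟩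
  refine ⟨x', fun l hl k hk => ⟨?_, fun d h0 hd => ?_⟩⟩
  · rcases eq_or_ne k 0 with rfl | hk0
    · simpa using (he l (intBox_mono (by nlinarith) hl)).1
    have hkN : k.natAbs ≤ N := by rw [Int.abs_eq_natAbs] at hk; exact_mod_cast hk
    rcases Int.natAbs_eq k with h' | h'
    · rw [h', natCast_zsmul, natCast_zsmul]
      exact (hpos l hl _ (Int.natAbs_pos.2 hk0) hkN).1
    · obtain ⟨h1, h2⟩ := hpos (-l) (neg_mem_intBox hl) _ (Int.natAbs_pos.2 hk0) hkN
      have h3 := h (-l) (neg_mem_intBox hl) _ (Int.natAbs_pos.2 hk0) hkN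
      have hneg : ∀ (e : (ι → ℤ) →+ H) (x : H),
          e l + k • x = -(e (-l) + k.natAbs • x) := by
        intro e x
        conv_lhs => rw [h']
        rw [neg_smul, natCast_zsmul, map_neg]; abel
      rw [hneg, hneg, neg_pos, neg_pos, ← not_iff_not, not_lt, not_lt,
        le_iff_lt_or_eq, le_iff_lt_or_eq, or_iff_left h3.symm, or_iff_left h2.symm]
      exact h1
  · have hdD : d ∣ D := Nat.dvd_factorial h0 hd
    have key := hx₀ l hl k hk d h0 hd
    have hg' : k • D • g ∈ multiples K d := zsmul_mem (nsmul_mem_multiples_of_dvd hdD hg) k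
    have heq : e' l + k • x' = e' l + k • x₀ + k • D • g := by
      rw [hx', zsmul_add]; abel
    rw [heq, add_mem_cancel_right hg', add_mem_cancel_right (multiples_mono_left le_top d hg')]
    exact key

end DensePair

/-! ### Counting patterns -/

/-- A set with at most `n` elements is listed by a function `Fin n → Option α`, padded with `none`.
-/
theorem card_filter_card_le {α : Type*} [Fintype α] [DecidableEq α] (n : ℕ) :
    (Finset.univ.filter fun s : Finset α => s.card ≤ n).card ≤ (Fintype.card α + 1) ^ n := by
  have h : (Finset.univ.filter fun s : Finset α => s.card ≤ n) ⊆
      Finset.univ.image fun f : Fin n → Option α => Finset.univ.filter fun a => ∃ i, f i = some a := by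
    intro s hs
    have hs' : s.card ≤ n := by simpa using hs
    refine Finset.mem_image.2 ⟨fun i => if h : (i : ℕ) < s.card then
      some (s.equivFin.symm ⟨i, h⟩ : s) else none, Finset.mem_univ _, ?_⟩
    ext a
    simp only [Finset.mem_filter, Finset.mem_univ, true_and]
    constructor
    · rintro ⟨i, hi⟩
      split_ifs at hi with h
      · rw [Option.some_inj] at hi
        rw [← hi]
        exact Subtype.coe_prop _
    · intro ha
      refine ⟨⟨s.equivFin ⟨a, ha⟩, (s.equivFin ⟨a, ha⟩).2.trans_le hs'⟩, ?_⟩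
      simp
  refine (Finset.card_le_card h).trans (Finset.card_image_le.trans ?_)
  simp

theorem ncard_range_le_of_determined {X Y Z : Type*} (f : X → Y) (g : X → Z)
    (h : ∀ x x', g x = g x' → f x = f x') (hg : (Set.range g).Finite) :
    (Set.range f).ncard ≤ (Set.range g).ncard := by
  rcases isEmpty_or_nonempty X with hX | hX
  · simp [Set.range_eq_empty]
  have : Set.range f = (fun z => f (Function.invFun g z)) '' Set.range g := by
    rw [← Set.range_comp]
    congr 1
    funext x
    exact (h _ _ (Function.invFun_eq ⟨x, rfl⟩)).symm
  rw [this]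
  exact Set.ncard_image_le hg

theorem ncard_range_le_of_finset {X I : Type*} [Fintype I] [DecidableEq I] (n : ℕ)
    (J : X → Finset I) (hJ : ∀ x, (J x).card ≤ n) :
    (Set.range J).ncard ≤ (Fintype.card I + 1) ^ n := by
  refine le_trans ?_ (card_filter_card_le (α := I) n)
  rw [← Set.ncard_coe_finset]
  refine Set.ncard_le_ncard ?_ (Finset.finite_toSet _)
  rintro _ ⟨x, rfl⟩
  simpa using hJ x

/-! ### Sign patterns of affine functions. -/

section Order

variable {H : Type*} [AddCommGroup H]

/-- An affine dependency prevents sign patterns from shattering. -/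
theorem not_both_sign_patterns [LinearOrder H] [IsOrderedAddMonoid H] {I : Type*} (T : Finset I) (g : I → ℤ) {i₀ : I} (hi₀ : i₀ ∈ T)
    (hg : 0 < g i₀) {f f' : I → H} (hsum : ∑ i ∈ T, g i • f i = ∑ i ∈ T, g i • f' i)
    (h : ∀ i ∈ T, 0 < f i ↔ 0 < g i) (h' : ∀ i ∈ T, 0 < f' i ↔ g i < 0) : False := by
  have h1 : 0 < ∑ i ∈ T, g i • f i := by
    refine Finset.sum_pos' (fun i hi => ?_) ⟨i₀, hi₀, ?_⟩
    · rcases lt_or_ge 0 (g i) with h0 | h0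
      · exact zsmul_nonneg ((h i hi).2 h0).le h0.le
      · have : f i ≤ 0 := not_lt.1 fun h2 => absurd ((h i hi).1 h2) h0.not_gt
        have h3 := zsmul_nonneg (neg_nonneg.2 this) (neg_nonneg.2 h0)
        rwa [neg_smul_neg] at h3
    · exact zsmul_pos ((h _ hi₀).2 hg) hg
  have h2 : ∑ i ∈ T, g i • f' i ≤ 0 := by
    refine Finset.sum_nonpos fun i hi => ?_
    rcases lt_or_ge (g i) 0 with h0 | h0
    · have h3 := zsmul_nonneg ((h' i hi).2 h0).le (neg_nonneg.2 h0.le)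
      rw [neg_smul] at h3
      exact neg_nonneg.1 h3
    · have : f' i ≤ 0 := not_lt.1 fun h2 => absurd ((h' i hi).1 h2) h0.not_gt
      have h3 := zsmul_nonneg (neg_nonneg.2 this) h0
      rw [zsmul_neg] at h3
      exact neg_nonneg.1 h3
  rw [hsum] at h1
  exact h1.not_ge h2

theorem sum_zsmul_affine {I : Type*} {n : ℕ} (T : Finset I) (g : I → ℤ) (β : I → Fin n → ℤ)
    (c : I → H) (hg : ∑ i ∈ T, g i • β i = 0) (b : Fin n → H) :
    ∑ i ∈ T, g i • (c i + ∑ j, β i j • b j) = ∑ i ∈ T, g i • c i := by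
  simp only [zsmul_add, Finset.sum_add_distrib, Finset.smul_sum, ← mul_smul]
  rw [Finset.sum_comm (s := T)]
  simp only [← Finset.sum_smul]
  have : ∀ j, ∑ i ∈ T, g i * β i j = 0 := fun j => by
    have := congrFun hg j
    simpa using this
  simp [this]

/-- The sign patterns of `s` affine functions in `n` variables number at most `(s + 1) ^ n`. -/
theorem ncard_range_sign_le [LinearOrder H] [IsOrderedAddMonoid H] {I : Type*} [Fintype I]
    {n : ℕ} (β : I → Fin n → ℤ) (c : I → H) :
    (Set.range fun b : Fin n → H => {i | 0 < c i + ∑ j, β i j • b j}).ncard ≤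
      (Fintype.card I + 1) ^ n := by
  classical
  let F : Finset (Finset I) := Finset.univ.filter fun s =>
    ∃ b : Fin n → H, ∀ i, i ∈ s ↔ 0 < c i + ∑ j, β i j • b j
  have hF : (Set.range fun b : Fin n → H => {i | 0 < c i + ∑ j, β i j • b j}) ⊆
      (fun s : Finset I => (s : Set I)) '' (F : Set (Finset I)) := by
    rintro _ ⟨b, rfl⟩
    refine ⟨Finset.univ.filter fun i => 0 < c i + ∑ j, β i j • b j, ?_, by ext; simp⟩
    simp only [F, Finset.coe_filter, Set.mem_ofPred_eq, Finset.mem_univ, true_and]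
    exact ⟨b, fun i => by simp⟩
  refine (Set.ncard_le_ncard hF ((Finset.finite_toSet _).image _)).trans
    ((Set.ncard_image_le (Finset.finite_toSet _)).trans ?_)
  rw [Set.ncard_coe_finset]
  -- A family has at most as many members as it shatters sets (Sauer-Shelah in Pajor's form), so it
  -- is enough that shattered sets have at most `n` elements.
  refine (Finset.card_le_card_shatterer F).trans
    ((Finset.card_le_card ?_).trans (card_filter_card_le (α := I) n))
  intro T hT
  simp only [Finset.mem_filter, Finset.mem_univ, true_and]
  rw [Finset.mem_shatterer] at hT
  by_contra hn
  have hdep : ¬ LinearIndepOn ℤ β (T : Set I) := fun hli => by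
    have := LinearIndependent.fintype_card_le_finrank hli
    simp at this
    exact hn this
  rw [linearIndepOn_finset_iff] at hdep
  push Not at hdep
  obtain ⟨g, hg, i₁, hi₁, hgi₁⟩ := hdep
  -- The dependency is normalised to have a positive coefficient; this makes the weighted sum
  -- strictly positive for the first sign pattern.
  obtain ⟨g, hg, i₀, hi₀, hgi₀⟩ : ∃ g : I → ℤ, ∑ i ∈ T, g i • β i = 0 ∧ ∃ i ∈ T, 0 < g i := by
    rcases hgi₁.lt_or_gt with h | h
    · exact ⟨fun i => -g i, by
        simp only [neg_smul, Finset.sum_neg_distrib, hg, neg_zero], i₁, hi₁, by simpa using h⟩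
    · exact ⟨g, hg, i₁, hi₁, h⟩
  have key : ∀ p : I → Prop, ∃ b : Fin n → H, ∀ i ∈ T, 0 < c i + ∑ j, β i j • b j ↔ p i := by
    intro p
    obtain ⟨s, hs, hsT⟩ := hT (Finset.filter_subset p T)
    simp only [F, Finset.mem_filter, Finset.mem_univ, true_and] at hs
    obtain ⟨b, hb⟩ := hs
    refine ⟨b, fun i hi => ?_⟩
    rw [← hb]
    have := Finset.ext_iff.1 hsT i
    simpa [hi] using this
  obtain ⟨b, hb⟩ := key fun i => 0 < g i
  obtain ⟨b', hb'⟩ := key fun i => g i < 0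
  exact not_both_sign_patterns T g hi₀ hgi₀ (by
    rw [sum_zsmul_affine T g β c hg, sum_zsmul_affine T g β c hg]) hb hb'

end Order

/-! ### Integral dependencies with a uniform multiplier. -/

theorem exists_common_multiple {α : Type*} (F : Finset α) {p : α → ℕ → Prop}
    (h : ∀ i ∈ F, ∃ M, 0 < M ∧ p i M) (hp : ∀ i M M', M ∣ M' → p i M → p i M') :
    ∃ M, 0 < M ∧ ∀ i ∈ F, p i M := by
  choose! M h0 hM using h
  exact ⟨∏ i ∈ F, M i, Finset.prod_pos h0, fun i hi => hp i _ _ (Finset.dvd_prod_of_mem M hi)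
    (hM i hi)⟩

/-- Take `T` a largest linearly independent subset. Adding `v` creates a relation whose coefficient
at `v` is nonzero, and its absolute value is the multiplier. -/
theorem exists_dependency {n : ℕ} (S : Finset (Fin n → ℤ)) :
    ∃ T ⊆ S, T.card ≤ n ∧ ∀ v ∈ S, ∃ M : ℕ, 0 < M ∧ ∃ a : (Fin n → ℤ) → ℤ,
      M • v = ∑ w ∈ T, a w • w := by
  classical
  obtain ⟨T, hT, hmax⟩ := Finset.exists_max_image
    (S.powerset.filter fun T : Finset (Fin n → ℤ) => LinearIndepOn ℤ id (T : Set (Fin n → ℤ))) Finset.card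
    ⟨∅, by simp⟩
  simp only [Finset.mem_filter, Finset.mem_powerset] at hT hmax
  refine ⟨T, hT.1, ?_, fun v hv => ?_⟩
  · have := LinearIndependent.fintype_card_le_finrank hT.2
    simpa using this
  by_cases hvT : v ∈ T
  · refine ⟨1, one_pos, fun w => if w = v then 1 else 0, ?_⟩
    simp [hvT]
  have hdep : ¬ LinearIndepOn ℤ id ((insert v T : Finset (Fin n → ℤ)) : Set (Fin n → ℤ)) := by
    intro hli
    have := hmax _ ⟨Finset.insert_subset hv hT.1, hli⟩
    rw [Finset.card_insert_of_notMem hvT] at this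
    omega
  rw [linearIndepOn_finset_iff] at hdep
  push Not at hdep
  obtain ⟨f, hf, i, hi, hfi⟩ := hdep
  rw [Finset.sum_insert hvT] at hf
  have hfv : f v ≠ 0 := by
    intro h0
    rw [h0, zero_smul, zero_add] at hf
    rcases Finset.mem_insert.1 hi with rfl | hiT
    · exact hfi h0
    · exact hfi (linearIndepOn_finset_iff.1 hT.2 f hf i hiT)
  have hf' : f v • v = ∑ w ∈ T, (-f w) • w := by
    simp only [neg_smul, Finset.sum_neg_distrib]
    exact eq_neg_of_add_eq_zero_left hf
  refine ⟨(f v).natAbs, Int.natAbs_pos.2 hfv, fun w => (f v).sign * -f w, ?_⟩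
  simp only [mul_smul]
  rw [← Finset.smul_sum, ← hf', ← mul_smul, ← natCast_zsmul, Int.sign_mul_self_eq_natAbs]

/-- A finite set has finitely many subsets, so one common multiple clears all denominators. This
keeps the modulus in the coset count independent of the index set. -/
theorem exists_uniform_dependency {n : ℕ} (V : Finset (Fin n → ℤ)) :
    ∃ M : ℕ, 0 < M ∧ ∀ S ⊆ V, ∃ T ⊆ S, T.card ≤ n ∧ ∀ v ∈ S, ∃ a : (Fin n → ℤ) → ℤ,
      M • v = ∑ w ∈ T, a w • w := by
  have hmul : ∀ (T : Finset (Fin n → ℤ)) (v : Fin n → ℤ) (M M' : ℕ), M ∣ M' →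
      (∃ a : (Fin n → ℤ) → ℤ, M • v = ∑ w ∈ T, a w • w) →
      ∃ a : (Fin n → ℤ) → ℤ, M' • v = ∑ w ∈ T, a w • w := by
    rintro T v M _ ⟨k, rfl⟩ ⟨a, ha⟩
    refine ⟨fun w => k • a w, ?_⟩
    rw [mul_nsmul, ha, Finset.smul_sum]
    simp only [smul_assoc]
  obtain ⟨M, hM, h⟩ := exists_common_multiple V.powerset (p := fun S M => ∃ T ⊆ S, T.card ≤ n ∧
      ∀ v ∈ S, ∃ a : (Fin n → ℤ) → ℤ, M • v = ∑ w ∈ T, a w • w)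
    (fun S _ => by
      obtain ⟨T, hTS, hT, h⟩ := exists_dependency S
      obtain ⟨M, hM, h'⟩ := exists_common_multiple S h (hmul T)
      exact ⟨M, hM, T, hTS, hT, h'⟩)
    (fun S M M' hd ⟨T, hTS, hT, h⟩ =>
      ⟨T, hTS, hT, fun v hv => hmul T v M M' hd (h v hv)⟩)
  exact ⟨M, hM, fun S hS => h S (Finset.mem_powerset.2 hS)⟩

/-! ### Coset patterns and the exponent `2 n`. -/

namespace DensePair

variable {H : Type*} [AddCommGroup H] [LinearOrder H] [IsOrderedAddMonoid H] {K : AddSubgroup H}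
  {u : H}

/-- The patterns of `s` coset conditions on affine functions in `n` variables with bounded
coefficients number `O(s ^ n)`. -/
theorem exists_ncard_range_coset_le (P : DensePair K u) (n N : ℕ) :
    ∃ C : ℕ, ∀ (I : Type) [Fintype I] (β : I → Fin n → ℤ) (c : I → H) (d : I → ℕ),
      (∀ i, β i ∈ intBox (Fin n) N) → (∀ i, 0 < d i ∧ d i ≤ N) →
      (Set.range fun b : Fin n → H =>
        {i | c i + ∑ j, β i j • b j ∈ multiples K (d i)}).ncard ≤
          (Fintype.card I * C + 1) ^ n := by
  classical
  obtain ⟨M, hM, hdep⟩ := exists_uniform_dependency (intBox_finite (ι := Fin n) N).toFinset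
  set D := N.factorial with hD
  have hMD : 0 < M * D := Nat.mul_pos hM N.factorial_pos
  refine ⟨M * D, fun I _ β c d hβ hd => ?_⟩
  set f : I → (Fin n → H) → H := fun i b => c i + ∑ j, β i j • b j with hf
  -- The code of `b` lists at most `n` indices whose coefficient vectors span, up to the multiplier
  -- `M`, those of all satisfied conditions, together with the residues of their values modulo `(M *
  -- D) K`. These values lie in `K`, so the residues exist.
  have hJ : ∀ b : Fin n → H, ∃ J : Finset (I × Fin (M * D)), J.card ≤ n ∧
      (∀ p ∈ J, f p.1 b - (p.2 : ℕ) • u ∈ multiples K (M * D)) ∧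
      ∀ i, f i b ∈ multiples K (d i) →
        ∃ a : I × Fin (M * D) → ℤ, M • β i = ∑ p ∈ J, a p • β p.1 := by
    intro b
    obtain ⟨T, hTS, hT, ha⟩ := hdep
      ((Finset.univ.filter fun i => f i b ∈ multiples K (d i)).image β) (by
        intro v hv
        obtain ⟨i, -, rfl⟩ := Finset.mem_image.1 hv
        simpa using hβ i)
    have hr : ∀ v ∈ T, ∃ p : I × Fin (M * D), β p.1 = v ∧
        f p.1 b - (p.2 : ℕ) • u ∈ multiples K (M * D) := by
      intro v hv
      obtain ⟨i, hi, rfl⟩ := Finset.mem_image.1 (hTS hv)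
      obtain ⟨y, hy, j, hj, he⟩ := P.div_mem (M * D) hMD _
        (multiples_le K _ (Finset.mem_filter.1 hi).2)
      exact ⟨(i, ⟨j, hj⟩), rfl, mem_multiples.2 ⟨y, hy, by simp [he]⟩⟩
    have : Nonempty (I × Fin (M * D)) ∨ T = ∅ := by
      rcases T.eq_empty_or_nonempty with h | ⟨v, hv⟩
      · exact Or.inr h
      · exact Or.inl ⟨(hr v hv).choose⟩
    rcases this with hne | rfl
    · choose! r hr1 hr2 using hr
      refine ⟨T.image r, Finset.card_image_le.trans hT, ?_, ?_⟩
      · intro p hp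
        obtain ⟨v, hv, rfl⟩ := Finset.mem_image.1 hp
        exact hr2 v hv
      · intro i hi
        obtain ⟨a, ha'⟩ := ha (β i) (Finset.mem_image_of_mem _ (by simpa using hi))
        refine ⟨fun p => a (β p.1), ?_⟩
        rw [ha', Finset.sum_image]
        · exact Finset.sum_congr rfl fun v hv => by simp only [hr1 v hv]
        · intro v hv w hw h
          rw [← hr1 v hv, ← hr1 w hw, h]
    · refine ⟨∅, by simp, by simp, fun i hi => ?_⟩
      obtain ⟨a, ha'⟩ := ha (β i) (Finset.mem_image_of_mem _ (by simpa using hi))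
      exact ⟨0, by simpa using ha'⟩
  choose J hJn hJ1 hJ2 using hJ
  -- For equal codes, `M` times the change of a satisfied value is a combination of changes lying in
  -- `(M * D) K`. Cancelling `M` puts the change in `D K`, hence in `(d i) K`.
  have hsub : ∀ b b', J b = J b' → ∀ i, f i b ∈ multiples K (d i) → f i b' ∈ multiples K (d i) := by
    intro b b' hbb i hi
    obtain ⟨a, ha⟩ := hJ2 b i hi
    have hdiff : ∀ i, f i b - f i b' = ∑ j, β i j • (b j - b' j) := by
      intro i
      simp only [hf, smul_sub, Finset.sum_sub_distrib]
      abel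
    have h1 : M • (f i b - f i b') = ∑ p ∈ J b, a p • (f p.1 b - f p.1 b') := by
      simp only [hdiff, Finset.smul_sum]
      rw [Finset.sum_comm]
      refine Finset.sum_congr rfl fun j _ => ?_
      have := congrFun ha j
      simp only [Pi.smul_apply, Finset.sum_apply, smul_eq_mul, nsmul_eq_mul] at this
      rw [← natCast_zsmul, ← mul_smul, this, Finset.sum_smul]
      simp only [mul_smul]
    have h2 : M • (f i b - f i b') ∈ multiples K (M * D) := by
      rw [h1]
      refine sum_mem fun p hp => zsmul_mem ?_ _
      have h3 := sub_mem (hJ1 b p hp) (hJ1 b' p (hbb ▸ hp))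
      simpa using h3
    rw [nsmul_mem_multiples_mul_iff hM.ne'] at h2
    have h3 := multiples_le_of_dvd K (Nat.dvd_factorial (hd i).1 (hd i).2) h2
    have h4 := sub_mem hi h3
    simpa using h4
  refine (ncard_range_le_of_determined _ J ?_ (Set.toFinite _)).trans
    ((ncard_range_le_of_finset n J hJn).trans (by simp))
  intro b b' h
  ext i
  exact ⟨hsub b b' h i, hsub b' b h.symm i⟩

/-- If `F x` depends only on the kinds of `s` affine functions with bounded coefficients at the
point `τ x` of `H ^ n`, then `F` takes `O(s ^ (2 n))` values. -/
theorem exists_ncard_range_le (P : DensePair K u) (n N : ℕ) :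
    ∃ C : ℕ, ∀ (I : Type) [Fintype I] (β : I → Fin n → ℤ) (c : I → H),
      (∀ i, β i ∈ intBox (Fin n) N) → ∀ {X Y : Type*} (τ : X → Fin n → H) (F : X → Y),
      (∀ x x', (∀ i, SameKind K N (c i + ∑ j, β i j • τ x j) (c i + ∑ j, β i j • τ x' j)) →
        F x = F x') →
      (Set.range F).ncard ≤ C * (Fintype.card I + 1) ^ (2 * n) := by
  obtain ⟨C, hC⟩ := P.exists_ncard_range_coset_le n N
  set D := N.factorial with hD
  have hD0 : 0 < D := N.factorial_pos
  refine ⟨(N * C + 1) ^ n * D ^ n, fun I _ β c hβ X Y τ F hF => ?_⟩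
  have hres : ∀ b : Fin n → H, ∃ r : Fin n → Fin D,
      ∀ j, b j - (r j : ℕ) • u ∈ multiples (⊤ : AddSubgroup H) D := by
    intro b
    have : ∀ j, ∃ r : Fin D, b j - (r : ℕ) • u ∈ multiples (⊤ : AddSubgroup H) D := by
      intro j
      obtain ⟨y, r, hr, he⟩ := P.div D hD0 (b j)
      exact ⟨⟨r, hr⟩, mem_multiples_top.2 ⟨y, by simp [he]⟩⟩
    exact ⟨fun j => (this j).choose, fun j => (this j).choose_spec⟩
  choose r hr using hres
  let g₁ : (Fin n → H) → Set I := fun b => {i | 0 < c i + ∑ j, β i j • b j}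
  let g₂ : (Fin n → H) → Set (I × Fin N) := fun b =>
    {i | c i.1 + ∑ j, β i.1 j • b j ∈ multiples K (i.2 + 1)}
  have h₁ : (Set.range g₁).ncard ≤ (Fintype.card I + 1) ^ n := ncard_range_sign_le β c
  have h₂ : (Set.range g₂).ncard ≤ (Fintype.card (I × Fin N) * C + 1) ^ n :=
    hC (I × Fin N) (fun i => β i.1) (fun i => c i.1) (fun i => i.2 + 1) (fun i => hβ i.1)
      (fun i => ⟨by omega, by omega⟩)
  have h₃ : (Set.range r).ncard ≤ D ^ n := by
    refine (Set.ncard_le_ncard (Set.subset_univ _)).trans ?_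
    rw [Set.ncard_univ]
    simp
  have hdet := ncard_range_le_of_determined F (fun x => ((g₁ (τ x), g₂ (τ x)), r (τ x))) (by
    intro x x' h
    simp only [Prod.mk.injEq] at h
    obtain ⟨⟨e₁, e₂⟩, e₃⟩ := h
    refine hF x x' fun i => ⟨Set.ext_iff.1 e₁ i, fun d h0 hd => ⟨?_, ?_⟩⟩
    · have := Set.ext_iff.1 e₂ (i, ⟨d - 1, by omega⟩)
      simpa only [g₂, Set.mem_ofPred_eq, Nat.sub_add_cancel h0] using this
    · have hdiff : (c i + ∑ j, β i j • τ x j) - (c i + ∑ j, β i j • τ x' j) ∈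
          multiples (⊤ : AddSubgroup H) d := by
        rw [add_sub_add_left_eq_sub, ← Finset.sum_sub_distrib]
        refine sum_mem fun j _ => ?_
        rw [← zsmul_sub]
        refine zsmul_mem (multiples_le_of_dvd _ (Nat.dvd_factorial h0 hd) ?_) _
        have h3 := sub_mem (hr (τ x) j) (hr (τ x') j)
        rw [e₃] at h3
        simpa using h3
      rw [← sub_add_cancel (c i + ∑ j, β i j • τ x j) (c i + ∑ j, β i j • τ x' j)]
      exact add_mem_cancel_left hdiff)
    (Set.toFinite _)
  have hsub : (Set.range fun x => ((g₁ (τ x), g₂ (τ x)), r (τ x))) ⊆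
      (Set.range g₁ ×ˢ Set.range g₂) ×ˢ Set.range r := by
    rintro _ ⟨x, rfl⟩
    exact ⟨⟨⟨_, rfl⟩, ⟨_, rfl⟩⟩, ⟨_, rfl⟩⟩
  refine hdet.trans ((Set.ncard_le_ncard hsub (Set.toFinite _)).trans ?_)
  rw [Set.ncard_prod, Set.ncard_prod]
  have h₂' : (Set.range g₂).ncard ≤ (N * C + 1) ^ n * (Fintype.card I + 1) ^ n := by
    refine h₂.trans ?_
    rw [← mul_pow]
    refine Nat.pow_le_pow_left ?_ n
    simp only [Fintype.card_prod, Fintype.card_fin]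
    nlinarith
  calc _ ≤ ((Fintype.card I + 1) ^ n * ((N * C + 1) ^ n * (Fintype.card I + 1) ^ n)) * D ^ n :=
        Nat.mul_le_mul (Nat.mul_le_mul h₁ h₂') h₃
    _ = _ := by ring

end DensePair

/-! ### Unwinding an oriented abelian group -/

namespace OrientedAddCommGroup

section Wrap

variable {A : Type*} [OrientedAddCommGroup A] {w x y z : A}

theorem ori_add_iff : ori (x + w) (y + w) (z + w) ↔ ori x y z :=
  ⟨fun h => by simpa using ori_add _ _ _ (-w) h, fun h => ori_add _ _ _ _ h⟩

theorem ori_iff_zero : ori x y z ↔ ori 0 (y - x) (z - x) := by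
  rw [← ori_add_iff (w := -x)]
  simp [sub_eq_add_neg]

theorem ori_rotate (h : ori x y z) : ori y z x := ori_cyclic _ _ _ h

theorem ori_trans (h : ori w x y) (h' : ori w y z) : ori w x z := by
  rw [ori_iff_zero] at *
  exact ori_zero_trans _ _ _ h h'

theorem ori_ne (h : ori x y z) : x ≠ y ∧ y ≠ z ∧ x ≠ z := by
  rw [ori_iff_zero] at h
  obtain ⟨h1, h2, h3⟩ := ori_zero_ne _ _ h
  exact ⟨fun e => h1 (by simp [e]), fun e => h3 (by simp [e]), fun e => h2 (by simp [e])⟩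

theorem ori_total (h1 : x ≠ y) (h2 : y ≠ z) (h3 : x ≠ z) : ori x y z ∨ ori x z y := by
  rw [ori_iff_zero, ori_iff_zero (y := z)]
  refine ori_zero_total _ _ (sub_ne_zero.2 h1.symm) (sub_ne_zero.2 h3.symm) ?_
  simpa using h2

theorem ori_asymm (h : ori x y z) : ¬ ori x z y := fun h' => (ori_ne (ori_trans h h')).2.1 rfl

/-- Linear order based at `0` recovers cyclic order: rotating both hypotheses makes them composable
at a common base point. -/
theorem ori_of_zero (h : ori 0 x y) (h' : ori 0 y z) : ori x y z :=
  ori_rotate (ori_rotate (ori_trans (ori_rotate h') (ori_rotate (ori_rotate h))))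

open Classical in
/-- The number of times that the positive path from `x` to `y` reaches `0` from below. -/
noncomputable def wrap (x y : A) : ℤ := if (y = 0 ∧ x ≠ 0) ∨ ori 0 y x then 1 else 0

theorem wrap_nonneg (x y : A) : 0 ≤ wrap x y := by
  unfold wrap; split_ifs <;> simp

theorem wrap_le_one (x y : A) : wrap x y ≤ 1 := by
  unfold wrap; split_ifs <;> simp

theorem wrap_self (x : A) : wrap x x = 0 := by
  refine if_neg ?_
  rintro (⟨h1, h2⟩ | h)
  · exact h2 h1
  · exact (ori_ne h).2.1 rfl

theorem wrap_zero_left (x : A) : wrap 0 x = 0 := by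
  refine if_neg ?_
  rintro (⟨-, h⟩ | h)
  · exact h rfl
  · exact (ori_ne h).2.2 rfl

theorem wrap_zero_right (h : x ≠ 0) : wrap x 0 = 1 := if_pos (Or.inl ⟨rfl, h⟩)

theorem wrap_eq_one_of_ori (h : ori 0 y x) : wrap x y = 1 := if_pos (Or.inr h)

theorem wrap_eq_zero_of_ori (h : ori 0 x y) : wrap x y = 0 := by
  refine if_neg ?_
  rintro (⟨h1, -⟩ | h')
  · exact (ori_ne h).2.2 h1.symm
  · exact ori_asymm h h'

theorem wrap_add_wrap (h : x ≠ y) : wrap x y + wrap y x = 1 := by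
  rcases eq_or_ne x 0 with rfl | hx
  · rw [wrap_zero_left, wrap_zero_right h.symm, zero_add]
  rcases eq_or_ne y 0 with rfl | hy
  · rw [wrap_zero_left, wrap_zero_right h, add_zero]
  rcases ori_total hx.symm h hy.symm with h | h <;>
    rw [wrap_eq_one_of_ori h, wrap_eq_zero_of_ori h] <;> rfl

/-- A positively oriented triangle goes round once and so reaches `0` exactly once. Arrival at `0`
counts and departure from it does not, which settles triangles with a vertex at `0`. -/
theorem wrap_cycle_of_ori (h : ori x y z) : wrap x y + wrap y z + wrap z x = 1 := by
  obtain ⟨h1, h2, h3⟩ := ori_ne h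
  rcases eq_or_ne x 0 with rfl | hx
  · rw [wrap_zero_left, wrap_zero_right h3.symm, wrap_eq_zero_of_ori h]; rfl
  rcases eq_or_ne y 0 with rfl | hy
  · rw [wrap_zero_left, wrap_zero_right h1, wrap_eq_zero_of_ori (ori_rotate h)]; rfl
  rcases eq_or_ne z 0 with rfl | hz
  · rw [wrap_zero_left, wrap_zero_right h2, wrap_eq_zero_of_ori (ori_rotate (ori_rotate h))]; rfl
  have no : ∀ {a b c : A}, ori a b c → ori 0 c b → ¬ ori 0 b a := fun h h1 h2 =>
    ori_asymm (ori_rotate h) (ori_rotate (ori_of_zero h1 h2))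
  rcases ori_total hx.symm h1 hy.symm with hxy | hxy <;>
  rcases ori_total hy.symm h2 hz.symm with hyz | hyz <;>
  rcases ori_total hz.symm h3.symm hx.symm with hzx | hzx
  · exact absurd rfl (ori_ne (ori_trans (ori_trans hxy hyz) hzx)).2.1
  · rw [wrap_eq_zero_of_ori hxy, wrap_eq_zero_of_ori hyz, wrap_eq_one_of_ori hzx]; rfl
  · rw [wrap_eq_zero_of_ori hxy, wrap_eq_one_of_ori hyz, wrap_eq_zero_of_ori hzx]; rfl
  · exact absurd hyz (no (ori_rotate h) hzx)
  · rw [wrap_eq_one_of_ori hxy, wrap_eq_zero_of_ori hyz, wrap_eq_zero_of_ori hzx]; rfl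
  · exact absurd hzx (no (ori_rotate (ori_rotate h)) hxy)
  · exact absurd hxy (no h hyz)
  · exact absurd rfl (ori_ne (ori_trans (ori_trans hxy hzx) hyz)).2.1

/-- The winding number of a triangle is invariant under translation. -/
theorem wrap_cycle_add (x y z w : A) :
    wrap (x + w) (y + w) + wrap (y + w) (z + w) + wrap (z + w) (x + w) =
      wrap x y + wrap y z + wrap z x := by
  have hp : ∀ {x y : A}, x ≠ y → wrap (x + w) (y + w) + wrap (y + w) (x + w) = 1 := fun h =>
    wrap_add_wrap (by simpa using h)
  rcases eq_or_ne x y with rfl | h1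
  · rcases eq_or_ne x z with rfl | h2
    · simp [wrap_self]
    · rw [wrap_self, wrap_self, zero_add, zero_add, hp h2, wrap_add_wrap h2]
  rcases eq_or_ne y z with rfl | h2
  · rw [wrap_self, wrap_self, add_zero, add_zero, hp h1, wrap_add_wrap h1]
  rcases eq_or_ne x z with rfl | h3
  · rw [wrap_self, wrap_self, add_zero, add_zero, hp h1, wrap_add_wrap h1]
  rcases ori_total h1 h2 h3 with h | h
  · rw [wrap_cycle_of_ori h, wrap_cycle_of_ori (ori_add _ _ _ w h)]
  · have e1 := wrap_cycle_of_ori h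
    have e2 := wrap_cycle_of_ori (ori_add _ _ _ w h)
    have := hp h1
    have := hp h2
    have := hp h3
    have := wrap_add_wrap h1
    have := wrap_add_wrap h2
    have := wrap_add_wrap h3
    omega

/-- The carry in the addition of representatives. -/
noncomputable def carry (x y : A) : ℤ := wrap x (x + y)

theorem carry_zero_left (x : A) : carry 0 x = 0 := wrap_zero_left _

theorem carry_zero_right (x : A) : carry x 0 = 0 := by rw [carry, add_zero, wrap_self]

theorem carry_nonneg (x y : A) : 0 ≤ carry x y := wrap_nonneg _ _

/-- The cocycle identity is translation invariance of winding numbers, applied to the triangle `0,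
y, y + z` translated by `x`. -/
theorem carry_assoc (x y z : A) :
    carry x y + carry (x + y) z = carry y z + carry x (y + z) := by
  have h := wrap_cycle_add 0 y (y + z) x
  rw [zero_add, add_comm y x, show y + z + x = x + y + z by abel, wrap_zero_left] at h
  simp only [carry, ← add_assoc]
  rcases eq_or_ne (y + z) 0 with h0 | h0
  · have : x + y + z = x := by rw [add_assoc, h0, add_zero]
    rw [this, h0, wrap_self, wrap_self] at h
    rw [this, h0, wrap_self]
    linarith
  · have h1 : x ≠ x + y + z := fun e => h0 (by rw [add_assoc] at e; simpa using e.symm)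
    have := wrap_add_wrap h1
    rw [wrap_zero_right h0] at h
    linarith

/-- Otherwise translations yield the closed chain `x <₀ -y <₀ -x - y <₀ -x <₀ y <₀ x + y <₀ x`. This
is what makes the carry symmetric and the unwinding commutative. -/
theorem ori_zero_add_of_ori_zero_add (hb : y ≠ 0) (h : ori 0 (x + y) x) : ori 0 (x + y) y := by
  obtain ⟨h1, h2, h3⟩ := ori_ne h
  by_contra hn
  have hx : ori 0 y (x + y) := (ori_total h1 (by simpa using h3.symm) hb.symm).resolve_left hn
  have e1 : ori 0 x (-y) := by
    have := ori_add _ _ _ (-y) hx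
    exact ori_rotate (by simpa using this)
  have e2 : ori 0 (-y) (-x - y) := by
    have := ori_add _ _ _ (-(x + y)) h
    rw [add_neg_cancel, show x + -(x + y) = -y by abel, zero_add,
      show -(x + y) = -x - y by abel] at this
    exact ori_rotate this
  have e3 : ori 0 (-x - y) (-x) := by
    have := ori_add _ _ _ (-x) e1
    exact ori_rotate (by simpa [sub_eq_add_neg, add_comm] using this)
  have e4 : ori 0 (-x) y := by
    have := ori_add _ _ _ (-x) h
    exact ori_rotate (ori_rotate (by simpa using this))
  exact (ori_ne (ori_trans e1 (ori_trans e2 (ori_trans e3 (ori_trans e4 (ori_trans hx h)))))).2.1 rfl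

theorem carry_comm (x y : A) : carry x y = carry y x := by
  rcases eq_or_ne x 0 with rfl | hx
  · rw [carry_zero_left, carry_zero_right]
  rcases eq_or_ne y 0 with rfl | hy
  · rw [carry_zero_left, carry_zero_right]
  have : ori 0 (x + y) x ↔ ori 0 (y + x) y := by
    rw [add_comm y x]
    refine ⟨ori_zero_add_of_ori_zero_add hy, fun h => ?_⟩
    rw [add_comm] at h ⊢
    exact ori_zero_add_of_ori_zero_add hx h
  have h : (x + y = 0 ∧ x ≠ 0) ∨ ori 0 (x + y) x ↔ (y + x = 0 ∧ y ≠ 0) ∨ ori 0 (y + x) y := by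
    rw [this, add_comm y x]
    simp only [hx, hy, ne_eq, not_false_eq_true, and_true]
  unfold carry wrap
  by_cases hw : (x + y = 0 ∧ x ≠ 0) ∨ ori 0 (x + y) x
  · rw [if_pos hw, if_pos (h.1 hw)]
  · rw [if_neg hw, if_neg (mt h.2 hw)]

end Wrap

/-- The unwinding of an oriented abelian group `A`: the ordered group whose quotient by an infinite
cyclic cofinal subgroup is `A`. -/
@[ext] structure Unwinding (A : Type*) where
  turns : ℤ
  pt : A

namespace Unwinding

variable {A : Type*} [OrientedAddCommGroup A]

noncomputable instance : Zero (Unwinding A) := ⟨⟨0, 0⟩⟩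
noncomputable instance : Add (Unwinding A) :=
  ⟨fun x y => ⟨x.turns + y.turns + carry x.pt y.pt, x.pt + y.pt⟩⟩
noncomputable instance : Neg (Unwinding A) := ⟨fun x => ⟨-x.turns - carry x.pt (-x.pt), -x.pt⟩⟩

@[simp] theorem turns_zero : (0 : Unwinding A).turns = 0 := rfl
@[simp] theorem pt_zero : (0 : Unwinding A).pt = 0 := rfl
@[simp] theorem turns_add (x y : Unwinding A) :
    (x + y).turns = x.turns + y.turns + carry x.pt y.pt := rfl
@[simp] theorem pt_add (x y : Unwinding A) : (x + y).pt = x.pt + y.pt := rfl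
@[simp] theorem turns_neg (x : Unwinding A) : (-x).turns = -x.turns - carry x.pt (-x.pt) := rfl
@[simp] theorem pt_neg (x : Unwinding A) : (-x).pt = -x.pt := rfl

noncomputable instance : AddCommGroup (Unwinding A) where
  add_assoc x y z := by
    ext
    · have := carry_assoc x.pt y.pt z.pt
      simp only [turns_add, pt_add]
      linarith
    · exact add_assoc _ _ _
  zero_add x := by ext <;> simp [carry_zero_left]
  add_zero x := by ext <;> simp [carry_zero_right]
  nsmul := nsmulRec
  zsmul := zsmulRec
  neg_add_cancel x := by
    ext
    · simp only [turns_add, turns_neg, pt_neg, turns_zero, carry_comm (-x.pt)]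
      ring
    · simp
  add_comm x y := by
    ext
    · simp [carry_comm, add_comm]
    · exact add_comm _ _

/-- The elements with a nonnegative number of turns. -/
noncomputable def cone (A : Type*) [OrientedAddCommGroup A] : AddGroupCone (Unwinding A) where
  carrier := {x | 0 ≤ x.turns}
  add_mem' {x y} hx hy := by
    have := carry_nonneg x.pt y.pt
    simp only [Set.mem_ofPred_eq, turns_add] at *
    omega
  zero_mem' := le_refl (0 : ℤ)
  eq_zero_of_mem_of_neg_mem' {x} hx hy := by
    simp only [Set.mem_ofPred_eq, turns_neg, carry, add_neg_cancel] at hx hy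
    have h1 := wrap_nonneg x.pt 0
    have h2 : x.pt = 0 := by
      by_contra h
      rw [wrap_zero_right h] at hy
      omega
    ext
    · simp; omega
    · exact h2

theorem mem_cone {x : Unwinding A} : x ∈ cone A ↔ 0 ≤ x.turns := Iff.rfl

instance : HasMemOrNegMem (cone A) where
  mem_or_neg_mem x := by
    simp only [mem_cone, turns_neg, carry, add_neg_cancel]
    have := wrap_le_one x.pt 0
    by_contra! h
    have hp : x.pt ≠ 0 := fun h0 => by
      rw [h0, wrap_self] at h
      omega
    omega

open Classical in
noncomputable instance : LinearOrder (Unwinding A) := LinearOrder.mkOfAddGroupCone (cone A)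

instance : IsOrderedAddMonoid (Unwinding A) := IsOrderedAddMonoid.mkOfCone (cone A)

theorem nonneg_iff {x : Unwinding A} : 0 ≤ x ↔ 0 ≤ x.turns := by
  show x - 0 ∈ cone A ↔ _
  rw [sub_zero, mem_cone]

/-- The projection to `A`. -/
def proj (A : Type*) [OrientedAddCommGroup A] : Unwinding A →+ A where
  toFun := pt
  map_zero' := rfl
  map_add' _ _ := rfl

/-- The full turn. -/
def turn (A : Type*) [OrientedAddCommGroup A] : Unwinding A := ⟨1, 0⟩

/-- The representative in the first turn. -/
def lift (a : A) : Unwinding A := ⟨0, a⟩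

@[simp] theorem proj_lift (a : A) : proj A (lift a) = a := rfl
@[simp] theorem proj_turn : proj A (turn A) = 0 := rfl
@[simp] theorem lift_zero : lift (0 : A) = 0 := rfl

theorem lift_injective {A : Type*} : Function.Injective (lift : A → Unwinding A) := fun _ _ h =>
  congrArg pt h

theorem zsmul_turn (k : ℤ) : k • turn A = ⟨k, 0⟩ := by
  let φ : ℤ →+ Unwinding A :=
    { toFun := fun k => ⟨k, 0⟩
      map_zero' := rfl
      map_add' := fun a b => by ext <;> simp [carry_zero_left] }
  have h := map_zsmul φ k 1
  rw [smul_eq_mul, mul_one] at h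
  exact h.symm

theorem eq_lift_add (x : Unwinding A) : x = lift (proj A x) + x.turns • turn A := by
  rw [zsmul_turn]
  ext
  · simp [lift, carry_zero_right]
  · simp [lift, proj]

theorem lift_nonneg (a : A) : 0 ≤ lift a := nonneg_iff.2 le_rfl

theorem turn_pos : 0 < turn A :=
  lt_of_le_of_ne (nonneg_iff.2 zero_le_one) fun h => zero_ne_one (congrArg turns h)

theorem lift_lt_turn (a : A) : lift a < turn A := by
  refine lt_of_le_of_ne (sub_nonneg.1 (nonneg_iff.2 ?_)) fun h => zero_ne_one (congrArg turns h)
  rw [sub_eq_add_neg]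
  simp only [turns_add, turns_neg, turn, lift, carry_zero_left]
  have := wrap_le_one a (a + -a)
  simp only [carry]
  omega

theorem lift_proj {x : Unwinding A} (h0 : 0 ≤ x) (h1 : x < turn A) : lift (proj A x) = x := by
  have hx := nonneg_iff.1 h0
  have h2 : x.turns = 0 := by
    by_contra hne
    have h3 : (1 : ℤ) ≤ x.turns := by omega
    have h4 : x.turns • turn A ≤ x := by
      conv_rhs => rw [eq_lift_add x]
      exact le_add_of_nonneg_left (lift_nonneg _)
    have h5 := zsmul_le_zsmul_left (turn_pos (A := A)).le h3
    rw [one_zsmul] at h5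
    exact absurd h1 (h5.trans h4).not_gt
  conv_rhs => rw [eq_lift_add x, h2, zero_smul, add_zero]

theorem lift_add_lift (a b : A) : lift a + lift b = ⟨carry a b, a + b⟩ := by
  ext <;> simp [lift]

theorem lift_lt_lift_of_ori {a b : A} (h : ori 0 a b) : lift a < lift b := by
  refine lt_of_le_of_ne ?_ fun e => (ori_ne h).2.1 (lift_injective e)
  have : lift b = lift a + lift (b - a) := by
    rw [lift_add_lift, carry, add_sub_cancel, wrap_eq_zero_of_ori h]; rfl
  rw [this]
  exact le_add_of_nonneg_right (lift_nonneg _)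

theorem lift_pos {a : A} (h : a ≠ 0) : 0 < lift a :=
  lt_of_le_of_ne (lift_nonneg a) fun e => h (lift_injective e.symm)

theorem ori_zero_iff {a b : A} : ori 0 a b ↔ a ≠ 0 ∧ lift a < lift b := by
  refine ⟨fun h => ⟨(ori_ne h).1.symm, lift_lt_lift_of_ori h⟩, fun ⟨h0, h⟩ => ?_⟩
  have hb : b ≠ 0 := by
    rintro rfl
    exact (h.trans_le (lift_zero (A := A)).le).not_ge (lift_nonneg a)
  rcases ori_total h0.symm (fun e => h.ne (congrArg lift e)) hb.symm with h1 | h1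
  · exact h1
  · exact absurd (lift_lt_lift_of_ori h1) h.not_gt

theorem ori_of_lift_lt {a b c : A} (h : lift a < lift b) (h' : lift b < lift c) : ori a b c := by
  have hb : b ≠ 0 := by
    rintro rfl
    exact (h.trans_le (lift_zero (A := A)).le).not_ge (lift_nonneg a)
  have h2 : ori 0 b c := ori_zero_iff.2 ⟨hb, h'⟩
  rcases eq_or_ne a 0 with rfl | ha
  · exact h2
  · exact ori_of_zero (ori_zero_iff.2 ⟨ha, h⟩) h2

/-- The orientation is the cyclic order of representatives. -/
theorem ori_iff_lift {a b c : A} : ori a b c ↔ (lift a < lift b ∧ lift b < lift c) ∨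
    (lift b < lift c ∧ lift c < lift a) ∨ (lift c < lift a ∧ lift a < lift b) := by
  refine ⟨fun h => ?_, ?_⟩
  · obtain ⟨h1, h2, h3⟩ := ori_ne h
    have no : ∀ {a b c : A}, ori a b c → lift c < lift b → lift b < lift a → False :=
      fun h h1 h2 => ori_asymm (ori_rotate h) (ori_rotate (ori_of_lift_lt h1 h2))
    rcases (lift_injective.ne h1).lt_or_gt with e1 | e1 <;>
    rcases (lift_injective.ne h2).lt_or_gt with e2 | e2 <;>
    rcases (lift_injective.ne h3).lt_or_gt with e3 | e3
    · exact Or.inl ⟨e1, e2⟩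
    · exact Or.inl ⟨e1, e2⟩
    · exact (no (ori_rotate h) e3 e2).elim
    · exact Or.inr (Or.inr ⟨e3, e1⟩)
    · exact (no (ori_rotate (ori_rotate h)) e1 e3).elim
    · exact Or.inr (Or.inl ⟨e2, e3⟩)
    · exact (no h e2 e1).elim
    · exact (no h e2 e1).elim
  · rintro (⟨h, h'⟩ | ⟨h, h'⟩ | ⟨h, h'⟩)
    · exact ori_of_lift_lt h h'
    · exact ori_rotate (ori_rotate (ori_of_lift_lt h h'))
    · exact ori_rotate (ori_of_lift_lt h h')

/-- The chain condition in regular density says that no carry occurs in forming the multiples of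
`c`, so they stay in the first turn. -/
theorem nsmul_lift {p : ℕ} {c : A} (h : ∀ i : ℕ, 1 ≤ i → i < p → ori 0 (i • c) ((i + 1) • c)) :
    ∀ i, 1 ≤ i → i ≤ p → i • lift c = lift (i • c) := by
  intro i hi
  induction i, hi using Nat.le_induction with
  | base => intro _; simp
  | succ i hi ih =>
    intro hip
    rw [succ_nsmul, ih (by omega), lift_add_lift, carry, ← succ_nsmul,
      wrap_eq_zero_of_ori (h i hi (by omega))]
    rfl

end Unwinding

end OrientedAddCommGroup

/-! ### From regular density to a dense pair. -/

namespace OrientedAddCommGroup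

namespace Unwinding

variable {A : Type*} [OrientedAddCommGroup A]

theorem exists_nsmul_eq {B : Type*} [AddCommGroup B]
    (h : ∀ p : ℕ, p.Prime → ∀ a : B, ∃ b, p • b = a) {d : ℕ} (hd : 0 < d) (a : B) :
    ∃ b, d • b = a := by
  induction d using induction_on_primes generalizing a with
  | zero => omega
  | one => exact ⟨a, one_nsmul a⟩
  | prime_mul p k hp ih =>
    obtain ⟨b, hb⟩ := h p hp a
    obtain ⟨c, hc⟩ := ih (Nat.pos_of_mul_pos_left hd) b
    exact ⟨c, by rw [mul_nsmul', hc, hb]⟩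

/-- Division with remainder in the unwinding by a divisor of the projection. -/
theorem exists_residue {d : ℕ} (hd : 0 < d) {x : Unwinding A} {b : A} (h : d • b = proj A x) :
    ∃ y, proj A y = b ∧ ∃ j : ℕ, j < d ∧ x = d • y + j • turn A := by
  have hd' : (0 : ℤ) < d := by exact_mod_cast hd
  set z := x - d • lift b with hz
  have h0 : proj A z = 0 := by rw [hz, map_sub, map_nsmul, proj_lift, h, sub_self]
  have hzt := eq_lift_add z
  rw [h0, lift_zero, zero_add] at hzt
  -- The error of the naive quotient `lift b` is a whole number of turns; Euclidean division of that
  -- number by `d` gives quotient and remainder.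
  refine ⟨lift b + (z.turns / d) • turn A, ?_, (z.turns % d).toNat, ?_, ?_⟩
  · rw [map_add, map_zsmul, proj_turn, smul_zero, add_zero, proj_lift]
  · have := Int.emod_nonneg z.turns hd'.ne'
    have := Int.emod_lt_of_pos z.turns hd'
    omega
  · have h1 : ((z.turns % d).toNat : ℤ) = z.turns % d :=
      Int.toNat_of_nonneg (Int.emod_nonneg _ hd'.ne')
    rw [nsmul_add, ← natCast_zsmul (turn A), h1, ← natCast_zsmul _ d, ← natCast_zsmul _ d,
      ← mul_smul, add_assoc, ← add_smul, Int.mul_ediv_add_emod, ← hzt, hz, natCast_zsmul]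
    abel

/-- A subgroup that contains a multiple of the full turn and is dense in the first turn is dense. -/
theorem exists_mem_between {S : AddSubgroup (Unwinding A)} {k : ℕ} (hk : 0 < k)
    (hS : k • turn A ∈ S)
    (h : ∀ x y : Unwinding A, 0 ≤ x → x < y → y < turn A → ∃ g ∈ S, x < g ∧ g < y)
    (hd : ∀ x y : Unwinding A, x < y → ∃ z, x < z ∧ z < y)
    {x y : Unwinding A} (hxy : x < y) : ∃ g ∈ S, x < g ∧ g < y := by
  have h' : ∀ x y : Unwinding A, 0 ≤ x → x < y → y ≤ turn A → ∃ g ∈ S, x < g ∧ g < y := by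
    intro x y hx hxy hy
    obtain ⟨z, h1, h2⟩ := hd x y hxy
    obtain ⟨g, hg, h3, h4⟩ := h x z hx h1 (h2.trans_le hy)
    exact ⟨g, hg, h3, h4.trans h2⟩
  have key : ∀ n : ℕ, ∀ x y : Unwinding A, 0 ≤ x → x < n • turn A → x < y →
      ∃ g ∈ S, x < g ∧ g < y := by
    intro n
    induction n with
    | zero => intro x y hx hx'; simp at hx'; exact absurd hx hx'.not_ge
    | succ n ih =>
      intro x y hx hx' hxy
      rcases lt_or_ge x (turn A) with h1 | h1
      · obtain ⟨g, hg, h2, h3⟩ := h' x (min y (turn A)) hx (lt_min hxy h1) (min_le_right _ _)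
        exact ⟨g, hg, h2, h3.trans_le (min_le_left _ _)⟩
      · have h2 : x - n • turn A < turn A := by
          rw [sub_lt_iff_lt_add']; rwa [succ_nsmul] at hx'
        -- The full turn need not lie in `S`, so the shift back by almost one turn uses an element
        -- `s` of `S` just large enough to bring `x - s` below `n` turns.
        obtain ⟨s, hs, h3, h4⟩ := h' (max 0 (x - n • turn A)) (turn A) (le_max_left _ _)
          (max_lt turn_pos h2) le_rfl
        obtain ⟨g, hg, h5, h6⟩ := ih (x - s) (y - s) (sub_nonneg.2 (h4.le.trans h1))
          (sub_lt_comm.1 ((le_max_right _ _).trans_lt h3)) (sub_lt_sub_right hxy s)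
        exact ⟨g + s, S.add_mem hg hs, sub_lt_iff_lt_add.1 h5, lt_sub_iff_add_lt.1 h6⟩
  have hge : ∀ x : Unwinding A, x.turns • turn A ≤ x := fun x => by
    conv_rhs => rw [eq_lift_add x]
    exact le_add_of_nonneg_left (lift_nonneg _)
  have hlt : ∀ x : Unwinding A, x < (x.turns + 1) • turn A := fun x => by
    conv_lhs => rw [eq_lift_add x]
    rw [add_smul, one_smul, add_comm]
    exact add_lt_add_right (lift_lt_turn _) _
  set m := x.turns.natAbs with hm
  have hpos : 0 ≤ x + m • k • turn A := by
    have h1 : (0 : ℤ) ≤ x.turns + m * k := by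
      have : (m : ℤ) ≤ m * k := le_mul_of_one_le_right (by positivity) (by exact_mod_cast hk)
      omega
    have h2 := add_le_add_left (hge x) (m • k • turn A)
    refine le_trans ?_ h2
    rw [← mul_nsmul', ← natCast_zsmul, ← add_smul]
    exact zsmul_nonneg turn_pos.le (by push_cast; exact h1)
  obtain ⟨g, hg, h1, h2⟩ := key ((x + m • k • turn A).turns + 1).toNat (x + m • k • turn A)
    (y + m • k • turn A) hpos (by
      have h3 := hlt (x + m • k • turn A)
      rw [← natCast_zsmul _ (Int.toNat _), Int.toNat_of_nonneg]
      · exact h3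
      · have := nonneg_iff.1 hpos
        omega)
    (add_lt_add_left hxy _)
  exact ⟨g - m • k • turn A, S.sub_mem hg (S.nsmul_mem hS m), lt_sub_iff_add_lt.2 h1,
    sub_lt_iff_lt_add.2 h2⟩

/-- This interpolation needs `0 < x`, since an orientation interval based at `0` requires distinct
nonzero endpoints; `exists_between` removes the restriction using infinitude. -/
theorem exists_between_lift (h : ∀ a b : A, ori 0 a b → ∃ c, ori a c b)
    {x y : Unwinding A} (hx : 0 < x) (hxy : x < y) (hy : y < turn A) : ∃ z, x < z ∧ z < y := by
  have hx' := lift_proj hx.le (hxy.trans hy)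
  have hy' := lift_proj (hx.le.trans hxy.le) hy
  have h1 : ori 0 (proj A x) (proj A y) := by
    refine ori_zero_iff.2 ⟨fun h0 => ?_, by rwa [hx', hy']⟩
    rw [h0, lift_zero] at hx'
    exact hx.ne hx'
  obtain ⟨c, hc⟩ := h _ _ h1
  rw [ori_iff_lift, hx', hy'] at hc
  rcases hc with ⟨h2, h3⟩ | ⟨-, h3⟩ | ⟨h3, -⟩
  · exact ⟨_, h2, h3⟩
  · exact absurd hxy h3.not_gt
  · exact absurd hxy h3.not_gt

/-- The unwinding of an infinite group with dense nonempty intervals is densely ordered. -/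
theorem exists_between [Infinite A] (h : ∀ a b : A, ori 0 a b → ∃ c, ori a c b)
    {x y : Unwinding A} (hxy : x < y) : ∃ z, x < z ∧ z < y := by
  suffices H : ∀ w : Unwinding A, 0 < w → ∃ z, 0 < z ∧ z < w by
    obtain ⟨z, h1, h2⟩ := H _ (sub_pos.2 hxy)
    exact ⟨x + z, lt_add_of_pos_right x h1, lt_sub_iff_add_lt'.1 h2⟩
  intro w hw
  classical
  rcases lt_trichotomy w (turn A) with h1 | rfl | h1
  -- If `w` were the least positive element, a point strictly above `w` in the first turn would
  -- force `w + w` below the turn. A point between `w` and `w + w` then differs from `w` by less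
  -- than `w`.
  · by_contra! hn
    obtain ⟨e, he⟩ := Infinite.exists_notMem_finset ({0, proj A w} : Finset A)
    simp only [Finset.mem_insert, Finset.mem_singleton, not_or] at he
    have he1 : w < lift e := lt_of_le_of_ne (hn _ (lift_pos he.1)) fun h0 =>
      he.2 (by rw [h0, proj_lift])
    obtain ⟨z, hz1, hz2⟩ := exists_between_lift h hw he1 (lift_lt_turn e)
    have h2 : w + w ≤ z := by
      rw [← le_sub_iff_add_le]
      exact hn _ (sub_pos.2 hz1)
    obtain ⟨v, hv1, hv2⟩ := exists_between_lift h hw (lt_add_of_pos_right w hw)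
      (h2.trans_lt (hz2.trans (lift_lt_turn e)))
    exact absurd (hn _ (sub_pos.2 hv1)) (sub_lt_iff_lt_add.2 hv2).not_ge
  · obtain ⟨e, he⟩ := exists_ne (0 : A)
    exact ⟨lift e, lift_pos he, lift_lt_turn e⟩
  · exact ⟨turn A, turn_pos, h1⟩

/-- The unwinding of a dense pair of divisible regularly dense oriented groups. -/
theorem densePair {G : AddSubgroup A} (hA : RegularlyDense A) (hG : RegularlyDense G)
    (hdA : ∀ p : ℕ, p.Prime → ∀ a : A, ∃ b, p • b = a)
    (hdG : ∀ p : ℕ, p.Prime → ∀ a : G, ∃ b, p • b = a)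
    (hdense : ∀ a x b : A, ori a x b → ∃ g ∈ G, ori a g b) [hinf : Infinite (A ⧸ G)] :
    DensePair (G.comap (proj A)) (turn A) := by
  have hAinf : Infinite A := Infinite.of_surjective _ (QuotientAddGroup.mk_surjective (s := G))
  have hbet : ∀ x y : Unwinding A, x < y → ∃ z, x < z ∧ z < y := fun x y hxy =>
    exists_between (fun a b hab => by
      obtain ⟨c, hc, -⟩ := hA 2 Nat.prime_two a b hab
      exact ⟨_, hc⟩) hxy
  have hturn : turn A ∈ G.comap (proj A) := by
    rw [AddSubgroup.mem_comap, proj_turn]; exact G.zero_mem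
  have hK : ∀ x y : Unwinding A, x < y → ∃ g ∈ G.comap (proj A), x < g ∧ g < y := by
    intro x y hxy
    refine exists_mem_between (k := 1) one_pos (by simp) ?_ hbet hxy
    intro x y hx hxy hy
    obtain ⟨z, h1, h2⟩ := hbet x y hxy
    have ex := lift_proj hx (hxy.trans hy)
    have ey := lift_proj (hx.trans hxy.le) hy
    have ez := lift_proj (hx.trans h1.le) (h2.trans hy)
    obtain ⟨g, hg, ho⟩ := hdense (proj A x) (proj A z) (proj A y)
      (ori_of_lift_lt (by rwa [ex, ez]) (by rwa [ez, ey]))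
    rw [ori_iff_lift, ex, ey] at ho
    rcases ho with ⟨h3, h4⟩ | ⟨-, h3⟩ | ⟨h3, -⟩
    · exact ⟨lift g, hg, h3, h4⟩
    · exact absurd hxy h3.not_gt
    · exact absurd hxy h3.not_gt
  have hp : ∀ p : ℕ, p.Prime → ∀ x y : Unwinding A, x < y →
      ∃ g ∈ G.comap (proj A), x < p • g ∧ p • g < y := by
    intro p hp x y hxy
    suffices H : ∃ g ∈ multiples (G.comap (proj A)) p, x < g ∧ g < y by
      obtain ⟨_, hg, h1, h2⟩ := H
      obtain ⟨g, hgK, rfl⟩ := mem_multiples.1 hg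
      exact ⟨g, hgK, h1, h2⟩
    refine exists_mem_between (k := p) hp.pos (mem_multiples.2 ⟨_, hturn, rfl⟩) ?_ hbet hxy
    intro x y hx hxy hy
    -- Regular density of `G` needs endpoints in `G`, the first nonzero, so the interval is first
    -- shrunk to one with endpoints in `K` and positive lower end.
    obtain ⟨g₂, hg₂, h3, h4⟩ := hK x y hxy
    obtain ⟨g₁, hg₁, h1, h2⟩ := hK x g₂ h3
    have e1 := lift_proj (hx.trans h1.le) ((h2.trans h4).trans hy)
    have e2 := lift_proj (hx.trans h3.le) (h4.trans hy)
    have h0 : proj A g₁ ≠ 0 := by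
      intro h0
      rw [h0, lift_zero] at e1
      exact (hx.trans_lt h1).ne e1
    obtain ⟨c, hc, hci⟩ := hG p hp ⟨proj A g₁, hg₁⟩ ⟨proj A g₂, hg₂⟩
      (show ori (0 : A) (proj A g₁) (proj A g₂) from ori_zero_iff.2 ⟨h0, by rwa [e1, e2]⟩)
    have hc' : ori (proj A g₁) (p • (c : A)) (proj A g₂) := hc
    have hl := nsmul_lift (c := (c : A)) hci p hp.one_le le_rfl
    rw [ori_iff_lift, e1, e2, ← hl] at hc'
    refine ⟨p • lift (c : A), mem_multiples.2 ⟨lift (c : A), by simp, rfl⟩, ?_⟩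
    rcases hc' with ⟨h5, h6⟩ | ⟨-, h5⟩ | ⟨h5, -⟩
    · exact ⟨h1.trans h5, h6.trans h4⟩
    · exact absurd h2 h5.not_gt
    · exact absurd h2 h5.not_gt
  refine ⟨turn_pos, hturn, fun d hd x => ?_, fun d hd x hx => ?_, fun d hd => ?_, ?_⟩
  · obtain ⟨b, hb⟩ := exists_nsmul_eq hdA hd (proj A x)
    obtain ⟨y, -, j, hj, he⟩ := exists_residue hd hb
    exact ⟨y, j, hj, he⟩
  · obtain ⟨b, hb⟩ := exists_nsmul_eq hdG hd ⟨proj A x, hx⟩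
    obtain ⟨y, hy, j, hj, he⟩ := exists_residue (x := x) (b := (b : A)) hd (congrArg Subtype.val hb)
    exact ⟨y, by rw [AddSubgroup.mem_comap, hy]; exact b.2, j, hj, he⟩
  · induction d using induction_on_primes with
    | zero => omega
    | one => simpa using hK
    | prime_mul p k hpp ih =>
      intro x y hxy
      -- For `d = p * k`, two multiples of `p` in the interval reduce the problem to finding a
      -- multiple of `k` between `g₁` and `g₂`.
      obtain ⟨g₂, -, h3, h4⟩ := hp p hpp x y hxy
      obtain ⟨g₁, -, h1, h2⟩ := hp p hpp x _ h3
      obtain ⟨g, hg, h5, h6⟩ := ih (Nat.pos_of_mul_pos_left hd) g₁ g₂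
        ((nsmul_right_strictMono hpp.ne_zero).lt_iff_lt.1 h2)
      refine ⟨g, hg, ?_, ?_⟩
      · rw [mul_nsmul']; exact h1.trans ((nsmul_right_strictMono hpp.ne_zero).lt_iff_lt.2 h5)
      · rw [mul_nsmul']; exact ((nsmul_right_strictMono hpp.ne_zero).lt_iff_lt.2 h6).trans h4
  · refine Infinite.of_surjective
      (QuotientAddGroup.map (G.comap (proj A)) G (proj A) le_rfl) fun q => ?_
    obtain ⟨a, rfl⟩ := QuotientAddGroup.mk_surjective q
    exact ⟨(lift a : Unwinding A), rfl⟩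

end Unwinding

theorem IsModel.exists_nsmul_eq {B : Type*} [OrientedAddCommGroup B] {e : Nat.Primes → ℕ∞}
    (h : IsModel B (fun _ => 0) e) (p : ℕ) (hp : p.Prime) (a : B) : ∃ b, p • b = a := by
  have h1 := h.primeIndex_eq ⟨p, hp⟩
  rw [ENat.epow_zero, primeIndex, ENat.card_eq_one_iff_unique] at h1
  obtain ⟨h1⟩ := h1
  have h2 : (a : B ⧸ (nsmulAddMonoidHom p : B →+ B).range) = (0 : B) := Subsingleton.elim _ _
  rw [QuotientAddGroup.eq] at h2
  obtain ⟨b, hb⟩ := h2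
  exact ⟨-b, by simp only [nsmulAddMonoidHom_apply] at hb; rw [smul_neg, hb]; simp⟩

theorem IsPairModel.densePair {A : Type*} [OrientedAddCommGroup A] {e₁ e₂ : Nat.Primes → ℕ∞}
    {G : AddSubgroup A} (h : IsPairModel (fun _ => 0) e₁ (fun _ => 0) e₂ G) :
    DensePair (G.comap (Unwinding.proj A)) (Unwinding.turn A) :=
  have := h.infinite_quotient
  Unwinding.densePair h.isModel.regularlyDense h.isModel_subgroup.regularlyDense
    h.isModel.exists_nsmul_eq h.isModel_subgroup.exists_nsmul_eq h.dense

end OrientedAddCommGroup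

/-! ### Formulas and linear combinations -/

/-- The homomorphism of integer linear combinations of a tuple. -/
def linComb {ι H : Type*} [Fintype ι] [AddCommGroup H] (c : ι → H) : (ι → ℤ) →+ H where
  toFun l := ∑ i, l i • c i
  map_zero' := by simp
  map_add' l k := by simp [add_smul, Finset.sum_add_distrib]

theorem linComb_apply {ι H : Type*} [Fintype ι] [AddCommGroup H] (c : ι → H) (l : ι → ℤ) :
    linComb c l = ∑ i, l i • c i := rfl

theorem linComb_single {ι H : Type*} [Fintype ι] [DecidableEq ι] [AddCommGroup H] (c : ι → H)
    (i : ι) : linComb c (Pi.single i 1) = c i := by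
  rw [linComb_apply, Finset.sum_eq_single i]
  · simp
  · intro j _ hj; simp [hj]
  · simp

theorem single_mem_intBox {ι : Type*} [DecidableEq ι] (i : ι) : Pi.single i 1 ∈ intBox ι 1 := by
  intro j
  rcases eq_or_ne j i with rfl | h
  · simp
  · simp [h]

namespace Agree

variable {H : Type*} [AddCommGroup H] [LinearOrder H] [IsOrderedAddMonoid H] {K : AddSubgroup H}
  {ι : Type*} {e e' : (ι → ℤ) →+ H} {N M M' : ℕ} {p q : ι → ℤ}

theorem lt_iff (h : Agree K N e e') (hp : p ∈ intBox ι M) (hq : q ∈ intBox ι M')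
    (hN : M + M' ≤ N) : e p < e q ↔ e' p < e' q := by
  have := (h (q + -p)
    (intBox_mono (by omega) (add_mem_intBox hq (neg_mem_intBox hp)))).1
  rwa [map_add, map_add, map_neg, map_neg, ← sub_eq_add_neg, ← sub_eq_add_neg, sub_pos,
    sub_pos] at this

theorem eq_iff (h : Agree K N e e') (hp : p ∈ intBox ι M) (hq : q ∈ intBox ι M')
    (hN : M + M' ≤ N) : e p = e q ↔ e' p = e' q := by
  have h1 := h.lt_iff hp hq hN
  have h2 := h.lt_iff hq hp (by omega)
  rw [eq_iff_le_not_lt, eq_iff_le_not_lt, ← not_lt, ← not_lt, h1, h2]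

end Agree

/-! ### Terms and formulas read in the unwinding. -/

namespace OrientedAddCommGroup

open Unwinding

variable {A : Type*} [OrientedAddCommGroup A]

/-- The full turn together with the representatives of a tuple. -/
def liftTuple {V : Type*} (v : V → A) : Option V → Unwinding A := fun i => i.elim (turn A) (lift ∘ v)

theorem exists_term_realize_eq (G : AddSubgroup A) {V : Type*} [Fintype V]
    (t : oriPairLanguage.Term V) :
    letI := oriPairStructure G
    ∃ l : V → ℤ, ∀ v : V → A, t.realize v = ∑ i, l i • v i := by
  classical
  let _ := oriPairStructure G
  induction t with
  | var i =>
    refine ⟨Pi.single i 1, fun v => ?_⟩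
    exact (linComb_single v i).symm
  | func f ts ih =>
    cases f with
    | zero => exact ⟨0, fun v => by simp only [Pi.zero_apply, zero_smul, Finset.sum_const_zero]; rfl⟩
    | neg =>
      obtain ⟨l, hl⟩ := ih 0
      refine ⟨-l, fun v => ?_⟩
      have : (Language.Term.func (L := oriPairLanguage) OriPairFunc.neg ts).realize v =
          -(ts 0).realize v := rfl
      rw [this, hl]
      simp
    | add =>
      obtain ⟨l, hl⟩ := ih 0
      obtain ⟨k, hk⟩ := ih 1
      refine ⟨l + k, fun v => ?_⟩
      have : (Language.Term.func (L := oriPairLanguage) OriPairFunc.add ts).realize v =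
          (ts 0).realize v + (ts 1).realize v := rfl
      rw [this, hl, hk]
      simp [add_smul, Finset.sum_add_distrib]

theorem abs_turns_le {M : ℕ} {x : Unwinding A} (h : |x| ≤ M • turn A) : |x.turns| ≤ M := by
  have hx := eq_lift_add x
  obtain ⟨h1, h2⟩ := abs_le.1 h
  rw [← natCast_zsmul] at h1 h2
  rw [abs_le]
  constructor
  · have h3 : (-(M : ℤ)) • turn A < (x.turns + 1) • turn A := by
      rw [neg_smul]
      refine h1.trans_lt ?_
      conv_lhs => rw [hx]
      rw [add_smul, one_smul, add_comm]
      exact add_lt_add_right (lift_lt_turn _) _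
    have := (zsmul_left_strictMono (turn_pos (A := A))).lt_iff_lt.1 h3
    omega
  · have h3 : x.turns • turn A ≤ (M : ℤ) • turn A := by
      refine le_trans ?_ h2
      conv_rhs => rw [hx]
      exact le_add_of_nonneg_left (lift_nonneg _)
    exact (zsmul_left_strictMono (turn_pos (A := A))).le_iff_le.1 h3

/-- The representative of the value of a term is a bounded linear combination, and the same one for
tuples that agree. -/
theorem exists_lift_term_eq (G : AddSubgroup A) {V : Type*} [Fintype V]
    (t : oriPairLanguage.Term V) :
    letI := oriPairStructure G
    ∃ M : ℕ, ∀ N, M + 1 ≤ N → ∀ v v' : V → A,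
      Agree (G.comap (proj A)) N (linComb (liftTuple v)) (linComb (liftTuple v')) →
      ∃ q ∈ intBox (Option V) M, lift (t.realize v) = linComb (liftTuple v) q ∧
        lift (t.realize v') = linComb (liftTuple v') q := by
  classical
  let _ := oriPairStructure G
  obtain ⟨l, hl⟩ := exists_term_realize_eq G t
  refine ⟨∑ i, (l i).natAbs, fun N hN v v' h => ?_⟩
  set M := ∑ i, (l i).natAbs with hM
  have hlin : ∀ (k : ℤ) (v : V → A), linComb (liftTuple v) (fun i => i.elim k l) =
      k • turn A + ∑ i, l i • lift (v i) := fun k v => by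
    simp [linComb_apply, Fintype.sum_option, liftTuple]
  have hproj : ∀ (k : ℤ) (v : V → A), proj A (linComb (liftTuple v) fun i => i.elim k l) =
      t.realize v := fun k v => by
    rw [hlin, hl]; simp
  set x : Unwinding A := ∑ i, l i • lift (v i) with hx
  have habs : |x| ≤ M • turn A := by
    refine (Finset.abs_sum_le_sum_abs _ _).trans ?_
    rw [hM, Finset.sum_smul]
    refine Finset.sum_le_sum fun i _ => ?_
    rw [abs_zsmul, abs_of_nonneg (lift_nonneg (v i)), Int.abs_eq_natAbs, natCast_zsmul]
    exact nsmul_le_nsmul_right (lift_lt_turn _).le _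
  have hq : (fun i : Option V => i.elim (-x.turns) l) ∈ intBox (Option V) M := by
    intro i
    cases i with
    | none => simpa using abs_turns_le habs
    | some i =>
      have : (l i).natAbs ≤ M :=
        Finset.single_le_sum (f := fun i => (l i).natAbs) (fun _ _ => Nat.zero_le _)
          (Finset.mem_univ i)
      simp only [Option.elim]
      rw [Int.abs_eq_natAbs]
      exact_mod_cast this
  set q : Option V → ℤ := fun i => i.elim (-x.turns) l with hqdef
  have h1 : linComb (liftTuple v) q = lift (t.realize v) := by
    have hxp : proj A x = t.realize v := by
      have := hproj 0 v
      rwa [hlin, zero_smul, zero_add] at this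
    rw [hqdef, hlin, ← hx, ← hxp]
    conv_lhs => rw [eq_lift_add x]
    simp [lift, carry_zero_right, zsmul_turn]
  have hturn : ∀ v : V → A, linComb (liftTuple v) (Pi.single none 1) = turn A := fun v =>
    linComb_single _ _
  -- Agreement transfers the inequalities `0 ≤ · < turn A` to the second tuple, so the same number
  -- of turns must be removed there. Comparison with the turn accounts for `M + 1`.
  refine ⟨q, hq, h1.symm, ?_⟩
  rw [← hproj (-x.turns) v', lift_proj]
  · have := h.lt_iff hq (M' := 0) (q := 0) (fun _ => by simp) (by omega)
    rw [map_zero, map_zero, ← not_iff_not, not_lt, not_lt, h1] at this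
    exact this.1 (lift_nonneg _)
  · have := h.lt_iff hq (single_mem_intBox none) hN
    rw [hturn, hturn, h1] at this
    exact this.1 (lift_lt_turn _)

theorem linComb_snoc {α : Type*} [Fintype α] {k : ℕ} (v : α → A) (xs : Fin k → A) (x : A)
    (l : Option (α ⊕ Fin (k + 1)) → ℤ) :
    linComb (liftTuple (Sum.elim v (Fin.snoc xs x : Fin (k + 1) → A))) l =
      linComb (liftTuple (Sum.elim v xs)) (l ∘ Option.map (Sum.map id Fin.castSucc)) +
        l (some (Sum.inr (Fin.last k))) • lift x := by
  simp [linComb_apply, Fintype.sum_option, Fin.sum_univ_castSucc, liftTuple, add_assoc]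

/-- The truth of a formula depends on finitely many conditions on linear combinations. -/
theorem exists_agree_realize_iff {G : AddSubgroup A}
    (P : DensePair (G.comap (proj A)) (turn A)) {α : Type} [Fintype α] {k : ℕ}
    (φ : oriPairLanguage.BoundedFormula α k) :
    letI := oriPairStructure G
    ∃ N₀, ∀ N, N₀ ≤ N → ∀ (v v' : α → A) (xs xs' : Fin k → A),
      Agree (G.comap (proj A)) N (linComb (liftTuple (Sum.elim v xs)))
        (linComb (liftTuple (Sum.elim v' xs'))) →
      (φ.Realize v xs ↔ φ.Realize v' xs') := by
  classical
  let _ := oriPairStructure G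
  induction φ with
  | falsum => exact ⟨0, fun _ _ _ _ _ _ _ => Iff.rfl⟩
  | equal t₁ t₂ =>
    obtain ⟨M₁, h₁⟩ := exists_lift_term_eq G t₁
    obtain ⟨M₂, h₂⟩ := exists_lift_term_eq G t₂
    refine ⟨M₁ + M₂ + 1, fun N hN v v' xs xs' h => ?_⟩
    obtain ⟨q₁, hq₁, e₁, e₁'⟩ := h₁ N (by omega) _ _ h
    obtain ⟨q₂, hq₂, e₂, e₂'⟩ := h₂ N (by omega) _ _ h
    show t₁.realize _ = t₂.realize _ ↔ t₁.realize _ = t₂.realize _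
    rw [← lift_injective.eq_iff, ← lift_injective.eq_iff (a := t₁.realize (Sum.elim v' xs')), e₁, e₂,
      e₁', e₂']
    exact h.eq_iff hq₁ hq₂ (by omega)
  | rel R ts =>
    cases R with
    | ori =>
      obtain ⟨M₁, h₁⟩ := exists_lift_term_eq G (ts 0)
      obtain ⟨M₂, h₂⟩ := exists_lift_term_eq G (ts 1)
      obtain ⟨M₃, h₃⟩ := exists_lift_term_eq G (ts 2)
      refine ⟨M₁ + M₂ + M₃ + 1, fun N hN v v' xs xs' h => ?_⟩
      obtain ⟨q₁, hq₁, e₁, e₁'⟩ := h₁ N (by omega) _ _ h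
      obtain ⟨q₂, hq₂, e₂, e₂'⟩ := h₂ N (by omega) _ _ h
      obtain ⟨q₃, hq₃, e₃, e₃'⟩ := h₃ N (by omega) _ _ h
      show ori ((ts 0).realize _) ((ts 1).realize _) ((ts 2).realize _) ↔
        ori ((ts 0).realize _) ((ts 1).realize _) ((ts 2).realize _)
      rw [ori_iff_lift, ori_iff_lift, e₁, e₂, e₃, e₁', e₂', e₃', h.lt_iff hq₁ hq₂ (by omega),
        h.lt_iff hq₂ hq₃ (by omega), h.lt_iff hq₃ hq₁ (by omega)]
    | sub =>
      obtain ⟨M, h₁⟩ := exists_lift_term_eq G (ts 0)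
      refine ⟨M + 1, fun N hN v v' xs xs' h => ?_⟩
      obtain ⟨q, hq, e, e'⟩ := h₁ N (by omega) _ _ h
      show (ts 0).realize _ ∈ G ↔ (ts 0).realize _ ∈ G
      have := ((h q (intBox_mono (by omega) hq)).2 1 one_pos (by omega)).1
      rwa [multiples_one, ← e, ← e', AddSubgroup.mem_comap, AddSubgroup.mem_comap, proj_lift,
        proj_lift] at this
  | imp f₁ f₂ ih₁ ih₂ =>
    obtain ⟨M₁, h₁⟩ := ih₁
    obtain ⟨M₂, h₂⟩ := ih₂
    refine ⟨M₁ + M₂, fun N hN v v' xs xs' h => ?_⟩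
    rw [Language.BoundedFormula.realize_imp, Language.BoundedFormula.realize_imp,
      h₁ N (by omega) v v' xs xs' h, h₂ N (by omega) v v' xs xs' h]
  | @all k f ih =>
    obtain ⟨M, hM⟩ := ih
    -- The bound `M + 1` admits the coefficients `1` of the turn and `-1` of `x` even when `M = 0`;
    -- they keep the matching point in `[0, turn A)`, where it represents an element of `A`.
    obtain ⟨N', hN'⟩ := P.exists_sameKind (ι := Option (α ⊕ Fin k)) (M + 1)
    have key : ∀ (v v' : α → A) (xs xs' : Fin k → A),
        Agree (G.comap (proj A)) N' (linComb (liftTuple (Sum.elim v xs)))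
          (linComb (liftTuple (Sum.elim v' xs'))) → ∀ x, ∃ x',
        (f.Realize v (Fin.snoc xs x) ↔ f.Realize v' (Fin.snoc xs' x')) := by
      intro v v' xs xs' h x
      obtain ⟨x', hx'⟩ := hN' _ _ h (Pi.single none 1) (single_mem_intBox none)
        (linComb_single _ _) (linComb_single _ _) (lift x)
      have h0 : 0 ≤ x' := by
        have := (hx' 0 (fun _ => by simp; positivity) (-1) (by simp)).1
        simp only [map_zero, zero_add, neg_smul, one_smul, neg_pos] at this
        rw [← not_iff_not, not_lt, not_lt] at this
        exact this.1 (lift_nonneg x)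
      have h1 : x' < turn A := by
        have := (hx' _ (intBox_mono (by omega) (single_mem_intBox none)) (-1) (by simp)).1
        simp only [linComb_single, neg_smul, one_smul, ← sub_eq_add_neg, sub_pos] at this
        exact this.1 (lift_lt_turn x)
      refine ⟨proj A x', hM M le_rfl v v' _ _ fun l hl => ?_⟩
      rw [linComb_snoc, linComb_snoc, lift_proj h0 h1]
      exact (hx' _ (intBox_mono (Nat.le_succ M) fun i => hl _) _
        ((hl _).trans (by push_cast; omega))).mono (Nat.le_succ M)
    refine ⟨N', fun N hN v v' xs xs' h => ?_⟩
    have h1 : Agree (G.comap (proj A)) N' (linComb (liftTuple (Sum.elim v xs)))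
        (linComb (liftTuple (Sum.elim v' xs'))) :=
      fun l hl => (h l (intBox_mono hN hl)).mono hN
    have h2 : Agree (G.comap (proj A)) N' (linComb (liftTuple (Sum.elim v' xs')))
        (linComb (liftTuple (Sum.elim v xs))) := fun l hl =>
      ⟨(h1 l hl).1.symm, fun d h0 hd =>
        ⟨((h1 l hl).2 d h0 hd).1.symm, ((h1 l hl).2 d h0 hd).2.symm⟩⟩
    rw [Language.BoundedFormula.realize_all, Language.BoundedFormula.realize_all]
    constructor
    · intro hall x
      obtain ⟨x', hx'⟩ := key _ _ _ _ h2 x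
      exact hx'.2 (hall x')
    · intro hall x
      obtain ⟨x', hx'⟩ := key _ _ _ _ h1 x
      exact hx'.2 (hall x')

/-- The trace of `ψ(A; b)` on `t` points depends on the kinds of `Λ.card * t` affine functions of
the lifts of `b`, one for each bounded coefficient vector and point. For `t ≥ 1` the additive `1` is
absorbed into `(Λ.card + 1) * t`. -/
theorem exists_shatterFunction_le {G : AddSubgroup A}
    (P : DensePair (G.comap (proj A)) (turn A)) {m n : ℕ}
    (ψ : oriPairLanguage.Formula (Fin m ⊕ Fin n)) :
    letI := oriPairStructure G
    ∃ C : ℕ, ∀ t, 1 ≤ t → shatterFunction (definableFamily A ψ) t ≤ C * t ^ (2 * n) := by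
  classical
  let _ := oriPairStructure G
  obtain ⟨N, hN⟩ := exists_agree_realize_iff P ψ
  obtain ⟨C, hC⟩ := P.exists_ncard_range_le n N
  let Λ : Finset (Option ((Fin m ⊕ Fin n) ⊕ Fin 0) → ℤ) := (intBox_finite N).toFinset
  refine ⟨C * (Λ.card + 1) ^ (2 * n), fun t ht => csSup_le' ?_⟩
  rintro _ ⟨B, rfl, rfl⟩
  have hbound := hC (Λ × Fin B.card)
    (fun i j => i.1.1 (some (Sum.inl (Sum.inr j))))
    (fun i => i.1.1 none • turn A +
      ∑ j, i.1.1 (some (Sum.inl (Sum.inl j))) • lift ((B.equivFin.symm i.2).1 j))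
    (fun i j => by
      have := i.1.2
      simp only [Λ, Set.Finite.mem_toFinset] at this
      exact this _)
    (fun (b : Fin n → A) j => lift (b j))
    (fun b => (B : Set (Fin m → A)) ∩ {a | ψ.Realize (Sum.elim a b)})
    (by
      intro b b' h
      ext a
      refine and_congr_right fun ha => hN N le_rfl _ _ _ _ fun l hl => ?_
      have h1 := h (⟨l, by simpa [Λ] using hl⟩, B.equivFin ⟨a, ha⟩)
      have h2 : ∀ b : Fin n → A,
          linComb (liftTuple (Sum.elim (Sum.elim a b) (default : Fin 0 → A))) l =
          l none • turn A + ∑ j, l (some (Sum.inl (Sum.inl j))) • lift (a j) +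
            ∑ j, l (some (Sum.inl (Sum.inr j))) • lift (b j) := fun b => by
        simp [linComb_apply, Fintype.sum_option, liftTuple, add_assoc]
      rw [h2, h2]
      simpa using h1)
  have himage : (fun s => (B : Set (Fin m → A)) ∩ s) '' definableFamily A ψ =
      Set.range fun b : Fin n → A =>
        (B : Set (Fin m → A)) ∩ {a | ψ.Realize (Sum.elim a b)} := by
    rw [definableFamily, ← Set.range_comp]; rfl
  rw [himage]
  refine hbound.trans ?_
  rw [mul_assoc, ← mul_pow]
  refine Nat.mul_le_mul_left C (Nat.pow_le_pow_left ?_ _)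
  simp only [Fintype.card_prod, Fintype.card_coe, Fintype.card_fin]
  nlinarith

end OrientedAddCommGroup

/-! ### From the shatter function to VC-density. -/

theorem vcDensity_le_of_shatterFunction_le {L : Language} {M : Type*} [L.Structure M] {m n : ℕ}
    (ψ : L.Formula (Fin m ⊕ Fin n)) {C k : ℕ}
    (h : ∀ t, 1 ≤ t → shatterFunction (definableFamily M ψ) t ≤ C * t ^ k) :
    vcDensity M ψ ≤ k := by
  refine iInf₂_le_of_le (k : ℝ≥0) ?_ (by simp)
  refine IsBigO.of_bound (C : ℝ) ((eventually_ge_atTop 1).mono fun t ht => ?_)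
  rw [NNReal.coe_natCast, Real.rpow_natCast, Real.norm_natCast, Real.norm_of_nonneg (by positivity)]
  exact_mod_cast h t ht

theorem mainTheorem6 {A : Type*} [OrientedAddCommGroup A] (G : AddSubgroup A)
    (hG : OrientedAddCommGroup.IsPairModel (fun _ => 0) (fun _ => 0) (fun _ => 0) (fun _ => 0) G ∨
      OrientedAddCommGroup.IsPairModel (fun _ => 0) (fun _ => ⊤) (fun _ => 0) (fun _ => 0) G ∨
      OrientedAddCommGroup.IsPairModel (fun _ => 0) (fun _ => ⊤) (fun _ => 0) (fun _ => ⊤) G)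
    (m n : ℕ) (ψ : oriPairLanguage.Formula (Fin m ⊕ Fin n)) :
    letI := oriPairStructure G
    vcDensity A ψ ≤ 2 * (n : ENNReal) := by
  let _ := oriPairStructure G
  have P : DensePair (G.comap (OrientedAddCommGroup.Unwinding.proj A))
      (OrientedAddCommGroup.Unwinding.turn A) := by
    rcases hG with h | h | h <;> exact h.densePair
  obtain ⟨C, hC⟩ := OrientedAddCommGroup.exists_shatterFunction_le P ψ
  refine (vcDensity_le_of_shatterFunction_le ψ hC).trans ?_
  push_cast
  exact le_rfl
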